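/- **Setting.** Let $\mathcal X\subset\mathbb R^{n_x}$ and $\mathcal Y\subset\mathbb R^{n_y}$ be compact convex sets with diameters at most $D_{\mathcal X}$ and $D_{\mathcal Y}$. Let $\mathcal L(x,y)$ be continuously differentiable on an open set containing $\mathcal X\times\mathcal Y$ and such that $\mathcal L(x,\cdot)$ is $\mu$-strongly concave on $\mathcal Y$ for every $x\in\mathcal X$, where $\mu\ge 0$ ($\mu=0$ means concave). Assume that there are constants $L_{xx},L_{yy}\ge 0$ and $L_{yx}>0$ such that for all $(x,y),(x',y')\in\mathcal X\times\mathcal Y$ $$\|\nabla_x\mathcal L(x,y)-\nabla_x\mathcal L(x',y')\|\le L_{xx}\|x-x'\|+L_{yx}\|y-y'\|,$$ $$\|\nabla_y\mathcal L(x,y)-\nabla_y\mathcal L(x',y')\|\le L_{yx}\|x-x'\|+L_{yy}\|y-y'\|.$$ Convexity of $\mathcal L(\cdot,y)$ is not assumed. Let $f(x)=\max_{y\in\mathcal Y}\mathcal L(x,y)$ and suppose $|f|\le M$ on $\mathcal X$. Define the Frank–Wolfe gap and the dual gap by $$G_{\mathcal X}(x,y)=\max_{v\in\mathcal X}\nabla_x\mathcal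 L(x,y)^\top(x-v),\qquad G_{\mathcal Y}(x,y)=\max_{u\in\mathcal Y}\mathcal L(x,u)-\mathcal L(x,y).$$ **Algorithm (LMO-PO).** Given stepsizes $\tau_t\in[0,1]$ and smoothing parameters $\beta_t\ge0$, start from any $x_0\in\mathcal X$, $y_0\in\mathcal Y$ and for $t=0,1,2,\dots$ put $$x_{t+1}=x_t+\tau_t(v_t-x_t)\ \text{ with any } v_t\in\arg\min_{v\in\mathcal X}\nabla_x\mathcal L(x_t,y_t)^\top v,$$ $$y_{t+1}=\mathrm{Proj}_{\mathcal Y}\Big(y_t+\tfrac{1}{L_{yy}+\beta_t}\nabla_y\mathcal L_{\beta_t}(x_t,y_t)\Big),\qquad \mathcal L_\beta(x,y)=\mathcal L(x,y)-\tfrac{\beta}{2}\|y-y_0\|^2 .$$ (If $L_{yy}+\beta_t=0$, which under the hypotheses below can only happen when $\mathcal Y$ is a single point, the projection is that point.) **Theorem.** (i) **NC-C.** Let $\tau_t=\Theta(t^{-3/4})$ with $\tau_t\in[0,1]$, and let $\beta_t>0$ be non-increasing with $\beta_t=\Theta(t^{-1/4})$. There is a constant $K$ such that for every $T\ge1$ $$\frac1T\sum_{t=1}^T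 G_{\mathcal X}(x_t,y_t)\le K\,T^{-1/4},\qquad \frac1T\sum_{t=1}^T G_{\mathcal Y}(x_t,y_t)\le K\,T^{-1/4}.$$ (ii) **NC-SC.** Let $\mu>0$, let $\tau_t=\Theta(t^{-1/2})$ with $\tau_t\in[0,1]$, and let $\beta_t=0$ for all $t$. There is a constant $K$ such that for every $T\ge1$ $$\frac1T\sum_{t=1}^T G_{\mathcal X}(x_t,y_t)\le K\,T^{-1/2},\qquad \frac1T\sum_{t=1}^T G_{\mathcal Y}(x_t,y_t)\le K\,\frac{1+\log T}{T},$$ the last bound being $\widetilde O(T^{-1})$. In both parts $K$ depends only on $D_{\mathcal X},D_{\mathcal Y},M,\mu,L_{xx},L_{yx},L_{yy}$ and on the parameter sequences $(\tau_t)$, $(\beta_t)$; it does not depend on $T$, the dimensions, the starting point, or the choices made by the oracle. -/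

import Mathlib

open Filter Asymptotics
open scoped Topology

noncomputable section MinimaxDefs

/-- `ℝⁿ` with its Euclidean norm. -/
abbrev Euc (n : ℕ) : Type := EuclideanSpace ℝ (Fin n)

variable {nx ny : ℕ}

/-- The partial gradient `∇ₓ 𝓛(x, y)`. -/
def gradX (L : Euc nx → Euc ny → ℝ) (x : Euc nx) (y : Euc ny) : Euc nx :=
  gradient (fun x' => L x' y) x

/-- The partial gradient `∇_y 𝓛(x, y)`. -/
def gradY (L : Euc nx → Euc ny → ℝ) (x : Euc nx) (y : Euc ny) : Euc ny :=
  gradient (fun y' => L x y') y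

/-- The standing assumptions on the feasible sets `X`, `Y` and the payoff `L`, with strong concavity
modulus `μ ≥ 0` (`μ = 0` is plain concavity) and smoothness constants `Lxx`, `Lyx`, `Lyy`. -/
structure MinimaxAssumption (X : Set (Euc nx)) (Y : Set (Euc ny)) (L : Euc nx → Euc ny → ℝ)
    (μ Lxx Lyx Lyy : ℝ) : Prop where
  compact_X : IsCompact X
  convex_X : Convex ℝ X
  compact_Y : IsCompact Y
  convex_Y : Convex ℝ Y
  mu_nonneg : 0 ≤ μ
  strongConcave : ∀ x ∈ X, StrongConcaveOn Y μ (fun y => L x y)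
  contDiff : ∃ U : Set (Euc nx × Euc ny), IsOpen U ∧ X ×ˢ Y ⊆ U ∧
    ContDiffOn ℝ 1 (fun p : Euc nx × Euc ny => L p.1 p.2) U
  Lxx_nonneg : 0 ≤ Lxx
  Lyy_nonneg : 0 ≤ Lyy
  Lyx_pos : 0 < Lyx
  lipschitz_gradX : ∀ x ∈ X, ∀ y ∈ Y, ∀ x' ∈ X, ∀ y' ∈ Y,
    ‖gradX L x y - gradX L x' y'‖ ≤ Lxx * ‖x - x'‖ + Lyx * ‖y - y'‖
  lipschitz_gradY : ∀ x ∈ X, ∀ y ∈ Y, ∀ x' ∈ X, ∀ y' ∈ Y,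
    ‖gradY L x y - gradY L x' y'‖ ≤ Lyx * ‖x - x'‖ + Lyy * ‖y - y'‖

/-- The primal function `f(x) = max_{y ∈ Y} 𝓛(x, y)`. -/
def primalFun (Y : Set (Euc ny)) (L : Euc nx → Euc ny → ℝ) (x : Euc nx) : ℝ :=
  sSup ((fun u => L x u) '' Y)

/-- The dual gap `max_{u ∈ Y} 𝓛(x, u) - 𝓛(x, y)`. -/
def dualGap (Y : Set (Euc ny)) (L : Euc nx → Euc ny → ℝ) (x : Euc nx) (y : Euc ny) : ℝ :=
  sSup ((fun u => L x u) '' Y) - L x y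

/-- The Frank–Wolfe gap `max_{v ∈ X} ∇ₓ 𝓛(x, y)ᵀ (x - v)`. -/
def fwGap (X : Set (Euc nx)) (L : Euc nx → Euc ny → ℝ) (x : Euc nx) (y : Euc ny) : ℝ :=
  sSup ((fun v => inner ℝ (gradX L x y) (x - v)) '' X)

/-- The regularized payoff `𝓛_β(x, y) = 𝓛(x, y) - (β / 2) ‖y - y₀‖²` with reference point `y₀`. -/
def regPayoff (L : Euc nx → Euc ny → ℝ) (y₀ : Euc ny) (β : ℝ) (x : Euc nx) (y : Euc ny) : ℝ :=
  L x y - β / 2 * ‖y - y₀‖ ^ 2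

/-- `v` is a valid answer of the linear minimization oracle of `S` in direction `d`. -/
def IsLMO {n : ℕ} (S : Set (Euc n)) (d v : Euc n) : Prop :=
  v ∈ S ∧ ∀ w ∈ S, inner ℝ d v ≤ inner ℝ d w

/-- `p` is the projection of `u` onto `S`: a minimizer of `‖u - v‖²` over `v ∈ S`. -/
def IsPO {n : ℕ} (S : Set (Euc n)) (u p : Euc n) : Prop :=
  p ∈ S ∧ ∀ w ∈ S, ‖u - p‖ ^ 2 ≤ ‖u - w‖ ^ 2

/-- `(x t, y t)` is generated by the hybrid LMO-PO algorithm with stepsizes `τ` and smoothing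
parameters `β`. The reference point of the regularization is the starting point `y 0`. -/
structure IsLMOPO (X : Set (Euc nx)) (Y : Set (Euc ny)) (L : Euc nx → Euc ny → ℝ) (Lyy : ℝ)
    (τ β : ℕ → ℝ) (x : ℕ → Euc nx) (y : ℕ → Euc ny) : Prop where
  init_x : x 0 ∈ X
  init_y : y 0 ∈ Y
  step_x : ∀ t, ∃ v, IsLMO X (gradX L (x t) (y t)) v ∧ x (t + 1) = x t + τ t • (v - x t)
  step_y : ∀ t, IsPO Y
    (y t + (1 / (Lyy + β t)) • gradY (regPayoff L (y 0) (β t)) (x t) (y t)) (y (t + 1))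

end MinimaxDefs

/-! The inner problem is made `(μ+β)`-strongly concave, so its maximizer `u t` at `x t` is unique
and moves slowly. Everything is controlled by the tracking error `e t = ‖y t - u t‖` and a potential
`φ t`, the regularized maximum plus `β t / 2 * DY ^ 2`.

Three inequalities carry the argument (`GapRecursion`). Tracking: the projected step contracts
towards `u t` (`projected_step`), while `u` drifts by at most `(Lyx τ DX + (β t - β (t+1)) DY) /
(μ+β)` (`norm_sub_le_of_isMaxOn`). Primal: the regularized maximum obeys a descent inequality with
constant of order `Lxx + Lyx² / (μ+β)`, so a Frank–Wolfe step with the inexact gradient at `y t`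
gives `τ G ≤ φ t - φ (t+1) + O(τ e + τ² / (μ+β))`. Dual: the gap after a step is `O(e² + τ e + τ² /
(μ+β))` plus the regularization bias `β DY² / 2`; first-order changes in `x` cancel up to `e`.

The rates come from summing these. In the concave case the contraction margin is of order
`t^(-1/4)`, and weighting by `(t+1)^(1/4)` gives `∑ e = O(n^(3/4))`. Division of the primal
inequality by `τ` costs a telescoping term `n^(3/4)`, and the bias sums to `n^(3/4)` as well. In the
strongly concave case the margin is constant and the drift is `t^(-1/2)`, so `∑ e = O(n^(1/2))` and
`∑ e² = O(1 + log n)`. No pointwise decay of `e` is needed. -/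

/-! ### First-order inequalities on convex sets. -/

section FirstOrder

variable {E : Type*} [NormedAddCommGroup E] [InnerProductSpace ℝ E] {S : Set E} {f : E → ℝ}

lemma HasGradientAt.hasDerivAt_comp_line [CompleteSpace E] {g a d : E} {s : ℝ}
    (hf : HasGradientAt f g (a + s • d)) :
    HasDerivAt (fun r : ℝ => f (a + r • d)) (inner ℝ g d) s := by
  have h1 : HasDerivAt (fun r : ℝ => a + r • d) d s := by
    simpa using ((hasDerivAt_id s).smul_const d).const_add a
  have h2 := hf.hasFDerivAt.comp_hasDerivAt s h1
  simpa [Function.comp_def] using h2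

/-- The descent lemma on a convex set. -/
lemma abs_sub_sub_inner_le_of_lipschitz_gradient [CompleteSpace E] {g : E → E} {K : ℝ}
    (hS : Convex ℝ S) (hf : ∀ x ∈ S, HasGradientAt f (g x) x)
    (hg : ∀ x ∈ S, ∀ y ∈ S, ‖g x - g y‖ ≤ K * ‖x - y‖) {x y : E} (hx : x ∈ S) (hy : y ∈ S) :
    |f y - f x - inner ℝ (g x) (y - x)| ≤ K / 2 * ‖y - x‖ ^ 2 := by
  set d := y - x with hd
  have hmem : ∀ s ∈ Set.Icc (0 : ℝ) 1, x + s • d ∈ S := fun s hs =>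
    hS.add_smul_sub_mem hx hy hs
  have hder : ∀ s ∈ Set.Icc (0 : ℝ) 1,
      HasDerivAt (fun r : ℝ => f (x + r • d) - f x - r * inner ℝ (g x) d)
        (inner ℝ (g (x + s • d)) d - inner ℝ (g x) d) s := by
    intro s hs
    have h1 := (hf _ (hmem s hs)).hasDerivAt_comp_line
    simpa using (h1.sub_const (f x)).fun_sub ((hasDerivAt_id s).mul_const (inner ℝ (g x) d))
  have hB : ∀ s : ℝ, HasDerivAt (fun r : ℝ => K / 2 * ‖d‖ ^ 2 * r ^ 2) (K * ‖d‖ ^ 2 * s) s := by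
    intro s
    have := (hasDerivAt_pow 2 s).const_mul (K / 2 * ‖d‖ ^ 2)
    refine this.congr_deriv ?_
    push_cast
    ring
  -- A mean value inequality replaces integration: the deviation from the linearization has
  -- derivative at most `K * ‖d‖ ^ 2 * s`, the derivative of the quadratic bound.
  have key := image_norm_le_of_norm_deriv_right_le_deriv_boundary
    (f := fun r : ℝ => f (x + r • d) - f x - r * inner ℝ (g x) d) (a := 0) (b := 1)
    (fun s hs => (hder s hs).continuousAt.continuousWithinAt)
    (fun s hs => (hder s (Set.Ico_subset_Icc_self hs)).hasDerivWithinAt) (by simp) hB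
    (fun s hs => by
      have hs' := Set.Ico_subset_Icc_self hs
      rw [← inner_sub_left, Real.norm_eq_abs]
      refine (abs_real_inner_le_norm _ _).trans ?_
      have := hg _ (hmem s hs') _ hx
      rw [add_sub_cancel_left, norm_smul, Real.norm_eq_abs, abs_of_nonneg hs'.1] at this
      nlinarith [norm_nonneg d])
    (Set.right_mem_Icc.2 zero_le_one)
  simpa [hd] using key

/-- The gradient inequality for strongly concave functions. -/
lemma StrongConcaveOn.le_add_inner_sub [CompleteSpace E] {m : ℝ} {g x y : E}
    (hf : StrongConcaveOn S m f) (hg : HasGradientAt f g x) (hx : x ∈ S) (hy : y ∈ S) :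
    f y ≤ f x + inner ℝ g (y - x) - m / 2 * ‖y - x‖ ^ 2 := by
  have hg' : HasGradientAt f g (x + (0 : ℝ) • (y - x)) := by simpa using hg
  have h1 := hg'.hasDerivAt_comp_line.tendsto_slope_zero_right
  -- Strong concavity on the chord, divided by `s`, bounds the slope from below by this function;
  -- then `s → 0+`.
  have h2 : Tendsto (fun s : ℝ => f y - f x + (1 - s) * (m / 2 * ‖y - x‖ ^ 2)) (𝓝[>] 0)
      (𝓝 (f y - f x + (1 - 0) * (m / 2 * ‖y - x‖ ^ 2))) := by
    refine Tendsto.mono_left (Continuous.tendsto ?_ 0) nhdsWithin_le_nhds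
    fun_prop
  have h3 := le_of_tendsto_of_tendsto h2 h1 (by
    filter_upwards [Ioc_mem_nhdsGT (zero_lt_one' ℝ)] with s hs
    obtain ⟨-, hconc⟩ := hf
    have h4 := hconc hx hy (sub_nonneg.2 hs.2) hs.1.le (sub_add_cancel 1 s)
    have h5 : (1 - s) • x + s • y = x + s • (y - x) := by module
    rw [h5, norm_sub_rev] at h4
    simp only [smul_eq_mul, zero_add, zero_smul, add_zero] at h4 ⊢
    rw [inv_mul_eq_div, le_div_iff₀ hs.1]
    nlinarith)
  linarith

lemma IsMaxOn.inner_gradient_sub_nonpos [CompleteSpace E] {g x y : E} (hS : Convex ℝ S)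
    (h : IsMaxOn f S x) (hg : HasGradientAt f g x) (hx : x ∈ S) (hy : y ∈ S) :
    inner ℝ g (y - x) ≤ 0 := by
  have := (IsMaxOn.localize h).hasFDerivWithinAt_nonpos hg.hasFDerivAt.hasFDerivWithinAt
    (sub_mem_posTangentConeAt_of_segment_subset (hS.segment_subset hx hy))
  simpa using this

/-- The variational inequality of the projection onto a convex set. -/
lemma inner_sub_sub_nonpos_of_forall_norm_sq_le (hS : Convex ℝ S) {u p w : E} (hp : p ∈ S)
    (h : ∀ w ∈ S, ‖u - p‖ ^ 2 ≤ ‖u - w‖ ^ 2) (hw : w ∈ S) : inner ℝ (u - p) (w - p) ≤ 0 := by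
  refine (norm_eq_iInf_iff_real_inner_le_zero hS hp).1 ?_ w hw
  have : Nonempty S := ⟨⟨p, hp⟩⟩
  refine le_antisymm (le_ciInf fun w => ?_) ?_
  · exact (sq_le_sq₀ (norm_nonneg _) (norm_nonneg _)).1 (h w w.2)
  · exact ciInf_le (f := fun w : S => ‖u - w‖)
      ⟨0, by rintro _ ⟨w, rfl⟩; exact norm_nonneg _⟩ ⟨p, hp⟩

/-- One projected gradient ascent step for an `l`-smooth, `σ`-strongly concave function. -/
lemma sub_le_of_projected_gradient_step (hS : Convex ℝ S) {l σ : ℝ} (hl : 0 < l) {g y p w : E}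
    (hlow : f y + inner ℝ g (p - y) - l / 2 * ‖p - y‖ ^ 2 ≤ f p)
    (hupp : f w ≤ f y + inner ℝ g (w - y) - σ / 2 * ‖w - y‖ ^ 2) (hp : p ∈ S) (hw : w ∈ S)
    (hproj : ∀ w ∈ S, ‖y + (1 / l) • g - p‖ ^ 2 ≤ ‖y + (1 / l) • g - w‖ ^ 2) :
    f w - f p ≤ (l - σ) / 2 * ‖y - w‖ ^ 2 - l / 2 * ‖p - w‖ ^ 2 := by
  have h1 := inner_sub_sub_nonpos_of_forall_norm_sq_le hS hp hproj hw
  have h2 : inner ℝ (y + (1 / l) • g - p) (w - p)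
      = inner ℝ (y - p) (w - p) + 1 / l * inner ℝ g (w - p) := by
    rw [← real_inner_smul_left, ← inner_add_left]
    congr 1
    abel
  rw [h2] at h1
  have h3 : l * inner ℝ (y - p) (w - p) + inner ℝ g (w - p) ≤ 0 := by
    have := mul_nonpos_of_nonneg_of_nonpos hl.le h1
    rw [mul_add, ← mul_assoc, mul_one_div_cancel hl.ne', one_mul] at this
    exact this
  have h4 : inner ℝ g (w - y) = inner ℝ g (w - p) + inner ℝ g (p - y) := by
    rw [← inner_add_right]
    congr 1
    abel
  have h5 : ‖y - w‖ ^ 2 = ‖y - p‖ ^ 2 - 2 * inner ℝ (y - p) (w - p) + ‖w - p‖ ^ 2 := by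
    rw [← norm_sub_sq_real]
    congr 2
    abel
  rw [norm_sub_rev p y] at hlow
  rw [norm_sub_rev w y] at hupp
  rw [norm_sub_rev w p] at h5
  nlinarith

end FirstOrder

/-! ### The regularized inner problem. -/

lemma norm_sub_le_of_diam_le {E : Type*} [SeminormedAddCommGroup E] {S : Set E} {D : ℝ}
    (hS : IsCompact S) (hD : Metric.diam S ≤ D) {a b : E} (ha : a ∈ S) (hb : b ∈ S) :
    ‖a - b‖ ≤ D := by
  rw [← dist_eq_norm]
  exact (Metric.dist_le_diam_of_mem hS.isBounded ha hb).trans hD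

namespace MinimaxAssumption

variable {nx ny : ℕ} {X : Set (Euc nx)} {Y : Set (Euc ny)} {L : Euc nx → Euc ny → ℝ}
  {μ Lxx Lyx Lyy : ℝ}

lemma hasGradientAt_gradX (h : MinimaxAssumption X Y L μ Lxx Lyx Lyy) {x : Euc nx} {y : Euc ny}
    (hx : x ∈ X) (hy : y ∈ Y) : HasGradientAt (fun x' => L x' y) (gradX L x y) x := by
  obtain ⟨U, hU, hXY, hL⟩ := h.contDiff
  have h1 : DifferentiableAt ℝ (fun p : Euc nx × Euc ny => L p.1 p.2) (x, y) :=
    (hL.differentiableOn one_ne_zero).differentiableAt (hU.mem_nhds (hXY ⟨hx, hy⟩))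
  have h2 : DifferentiableAt ℝ (fun x' : Euc nx => (x', y)) x := by fun_prop
  exact (DifferentiableAt.comp x h1 h2).hasGradientAt

lemma hasGradientAt_gradY (h : MinimaxAssumption X Y L μ Lxx Lyx Lyy) {x : Euc nx} {y : Euc ny}
    (hx : x ∈ X) (hy : y ∈ Y) : HasGradientAt (fun y' => L x y') (gradY L x y) y := by
  obtain ⟨U, hU, hXY, hL⟩ := h.contDiff
  have h1 : DifferentiableAt ℝ (fun p : Euc nx × Euc ny => L p.1 p.2) (x, y) :=
    (hL.differentiableOn one_ne_zero).differentiableAt (hU.mem_nhds (hXY ⟨hx, hy⟩))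
  have h2 : DifferentiableAt ℝ (fun y' : Euc ny => (x, y')) y := by fun_prop
  exact (DifferentiableAt.comp y h1 h2).hasGradientAt

lemma hasGradientAt_regPayoff (h : MinimaxAssumption X Y L μ Lxx Lyx Lyy) (y₀ : Euc ny) (β : ℝ)
    {x : Euc nx} {y : Euc ny} (hx : x ∈ X) (hy : y ∈ Y) :
    HasGradientAt (regPayoff L y₀ β x) (gradY L x y - β • (y - y₀)) y := by
  have h1 := (h.hasGradientAt_gradY hx hy).hasFDerivAt
  have h2 : HasFDerivAt (fun y' : Euc ny => ‖y' - y₀‖ ^ 2) _ y :=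
    ((hasFDerivAt_id y).sub_const y₀).norm_sq
  have h3 := h1.fun_sub (h2.const_mul (β / 2))
  rw [hasGradientAt_iff_hasFDerivAt]
  refine h3.congr_fderiv ?_
  ext v
  simp
  ring

lemma gradY_regPayoff (h : MinimaxAssumption X Y L μ Lxx Lyx Lyy) (y₀ : Euc ny) (β : ℝ)
    {x : Euc nx} {y : Euc ny} (hx : x ∈ X) (hy : y ∈ Y) :
    gradY (regPayoff L y₀ β) x y = gradY L x y - β • (y - y₀) :=
  (h.hasGradientAt_regPayoff y₀ β hx hy).gradient

lemma abs_sub_sub_inner_gradX_le (h : MinimaxAssumption X Y L μ Lxx Lyx Lyy) {x x' : Euc nx}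
    {y : Euc ny} (hx : x ∈ X) (hx' : x' ∈ X) (hy : y ∈ Y) :
    |L x' y - L x y - inner ℝ (gradX L x y) (x' - x)| ≤ Lxx / 2 * ‖x' - x‖ ^ 2 :=
  abs_sub_sub_inner_le_of_lipschitz_gradient (f := fun x => L x y) (g := fun x => gradX L x y)
    h.convex_X (fun _ hz => h.hasGradientAt_gradX hz hy)
    (fun a ha b hb => by simpa using h.lipschitz_gradX a ha y hy b hb y hy) hx hx'

lemma norm_gradX_sub_le (h : MinimaxAssumption X Y L μ Lxx Lyx Lyy) {x : Euc nx}
    {y y' : Euc ny} (hx : x ∈ X) (hy : y ∈ Y) (hy' : y' ∈ Y) :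
    ‖gradX L x y - gradX L x y'‖ ≤ Lyx * ‖y - y'‖ := by
  simpa using h.lipschitz_gradX x hx y hy x hx y' hy'

lemma inner_gradX_sub_le (h : MinimaxAssumption X Y L μ Lxx Lyx Lyy) {x : Euc nx}
    {y y' : Euc ny} (hx : x ∈ X) (hy : y ∈ Y) (hy' : y' ∈ Y) (d : Euc nx) :
    inner ℝ (gradX L x y) d ≤ inner ℝ (gradX L x y') d + Lyx * ‖y - y'‖ * ‖d‖ := by
  have h1 := (real_inner_le_norm (gradX L x y - gradX L x y') d).trans
    (mul_le_mul_of_nonneg_right (h.norm_gradX_sub_le hx hy hy') (norm_nonneg d))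
  rw [inner_sub_left] at h1
  linarith

lemma norm_sub_sq_shift {n : ℕ} (u y y₀ : Euc n) :
    ‖u - y₀‖ ^ 2 = ‖y - y₀‖ ^ 2 + 2 * inner ℝ (y - y₀) (u - y) + ‖u - y‖ ^ 2 := by
  rw [← norm_add_sq_real]
  congr 2
  abel

lemma regPayoff_le (h : MinimaxAssumption X Y L μ Lxx Lyx Lyy) (y₀ : Euc ny) (β : ℝ)
    {x : Euc nx} {y u : Euc ny} (hx : x ∈ X) (hy : y ∈ Y) (hu : u ∈ Y) :
    regPayoff L y₀ β x u ≤ regPayoff L y₀ β x y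
      + inner ℝ (gradY L x y - β • (y - y₀)) (u - y) - (μ + β) / 2 * ‖u - y‖ ^ 2 := by
  have h1 := (h.strongConcave x hx).le_add_inner_sub (h.hasGradientAt_gradY hx hy) hy hu
  unfold regPayoff
  rw [norm_sub_sq_shift u y y₀, inner_sub_left (gradY L x y), real_inner_smul_left]
  linarith

lemma le_regPayoff (h : MinimaxAssumption X Y L μ Lxx Lyx Lyy) (y₀ : Euc ny) (β : ℝ)
    {x : Euc nx} {y u : Euc ny} (hx : x ∈ X) (hy : y ∈ Y) (hu : u ∈ Y) :
    regPayoff L y₀ β x y + inner ℝ (gradY L x y - β • (y - y₀)) (u - y)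
      - (Lyy + β) / 2 * ‖u - y‖ ^ 2 ≤ regPayoff L y₀ β x u := by
  have h1 := abs_sub_sub_inner_le_of_lipschitz_gradient (f := fun y => L x y)
    (g := fun y => gradY L x y) (K := Lyy) h.convex_Y
    (fun _ hz => h.hasGradientAt_gradY hx hz)
    (fun a ha b hb => by simpa using h.lipschitz_gradY x hx a ha x hx b hb) hy hu
  have h2 := (abs_le.1 h1).1
  unfold regPayoff
  rw [norm_sub_sq_shift u y y₀, inner_sub_left (gradY L x y), real_inner_smul_left]
  linarith

lemma continuousOn_regPayoff (h : MinimaxAssumption X Y L μ Lxx Lyx Lyy) (y₀ : Euc ny) (β : ℝ)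
    {x : Euc nx} (hx : x ∈ X) : ContinuousOn (regPayoff L y₀ β x) Y := fun _ hy =>
  (h.hasGradientAt_regPayoff y₀ β hx hy).hasFDerivAt.continuousAt.continuousWithinAt

lemma exists_isMaxOn_regPayoff (h : MinimaxAssumption X Y L μ Lxx Lyx Lyy) (y₀ : Euc ny) (β : ℝ)
    (hY : Y.Nonempty) {x : Euc nx} (hx : x ∈ X) :
    ∃ y ∈ Y, IsMaxOn (regPayoff L y₀ β x) Y y :=
  h.compact_Y.exists_isMaxOn hY (h.continuousOn_regPayoff y₀ β hx)

lemma bddAbove_image (h : MinimaxAssumption X Y L μ Lxx Lyx Lyy) {x : Euc nx} (hx : x ∈ X) :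
    BddAbove ((fun u => L x u) '' Y) :=
  (h.compact_Y.image_of_continuousOn fun _ hy =>
    (h.hasGradientAt_gradY hx hy).hasFDerivAt.continuousAt.continuousWithinAt).bddAbove

lemma le_primalFun (h : MinimaxAssumption X Y L μ Lxx Lyx Lyy) {x : Euc nx} {y : Euc ny}
    (hx : x ∈ X) (hy : y ∈ Y) : L x y ≤ primalFun Y L x :=
  le_csSup (h.bddAbove_image hx) ⟨y, hy, rfl⟩

/-- Quadratic growth around the maximizer of the regularized payoff. -/
lemma regPayoff_add_le_of_isMaxOn (h : MinimaxAssumption X Y L μ Lxx Lyx Lyy) {y₀ : Euc ny}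
    {β : ℝ} {x : Euc nx} {y u : Euc ny} (hx : x ∈ X) (hy : y ∈ Y) (hu : u ∈ Y)
    (hmax : IsMaxOn (regPayoff L y₀ β x) Y y) :
    regPayoff L y₀ β x u + (μ + β) / 2 * ‖u - y‖ ^ 2 ≤ regPayoff L y₀ β x y := by
  have h1 := h.regPayoff_le y₀ β hx hy hu
  have h2 := hmax.inner_gradient_sub_nonpos h.convex_Y (h.hasGradientAt_regPayoff y₀ β hx hy) hy hu
  linarith

/-- The maximizer of the regularized payoff is Lipschitz in the primal variable and in the
regularization parameter. -/
lemma norm_sub_le_of_isMaxOn (h : MinimaxAssumption X Y L μ Lxx Lyx Lyy) {y₀ : Euc ny}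
    {D β β' : ℝ} (hσ : 0 < μ + β) (hβ : β' ≤ β) {x x' : Euc nx} {y y' : Euc ny} (hx : x ∈ X)
    (hx' : x' ∈ X) (hy : y ∈ Y) (hy' : y' ∈ Y) (hD : ‖y' - y₀‖ ≤ D)
    (hmax : IsMaxOn (regPayoff L y₀ β x) Y y) (hmax' : IsMaxOn (regPayoff L y₀ β' x') Y y') :
    ‖y - y'‖ ≤ (Lyx * ‖x - x'‖ + (β - β') * D) / (μ + β) := by
  have h1 := h.regPayoff_add_le_of_isMaxOn hx hy hy' hmax
  have h2 := h.regPayoff_le y₀ β hx hy' hy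
  have h3 := hmax'.inner_gradient_sub_nonpos h.convex_Y
    (h.hasGradientAt_regPayoff y₀ β' hx' hy') hy' hy
  -- Both gradients are taken at `y'`, so optimality of `y'` for `(x', β')` removes one term and
  -- only the perturbation of the data remains.
  have h4 : inner ℝ (gradY L x y' - β • (y' - y₀)) (y - y')
      = inner ℝ (gradY L x' y' - β' • (y' - y₀)) (y - y')
        + inner ℝ (gradY L x y' - gradY L x' y' - (β - β') • (y' - y₀)) (y - y') := by
    rw [← inner_add_left]
    congr 1
    module
  have h5 : ‖gradY L x y' - gradY L x' y' - (β - β') • (y' - y₀)‖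
      ≤ Lyx * ‖x - x'‖ + (β - β') * D := by
    refine (norm_sub_le _ _).trans (add_le_add ?_ ?_)
    · simpa using h.lipschitz_gradY x hx y' hy' x' hx' y' hy'
    · rw [norm_smul, Real.norm_of_nonneg (sub_nonneg.2 hβ)]
      exact mul_le_mul_of_nonneg_left hD (sub_nonneg.2 hβ)
  have h6 := (real_inner_le_norm (gradY L x y' - gradY L x' y' - (β - β') • (y' - y₀))
    (y - y')).trans (mul_le_mul_of_nonneg_right h5 (norm_nonneg _))
  rw [norm_sub_rev y' y] at h1
  have h7 : (μ + β) * ‖y - y'‖ ^ 2 ≤ (Lyx * ‖x - x'‖ + (β - β') * D) * ‖y - y'‖ := by linarith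
  rw [le_div_iff₀ hσ]
  rcases (norm_nonneg (y - y')).eq_or_lt with h0 | h0
  · rw [← h0, zero_mul]
    exact (norm_nonneg _).trans h5
  · nlinarith

/-- Smoothness of the regularized primal function. -/
lemma regPayoff_sub_le_of_isMaxOn (h : MinimaxAssumption X Y L μ Lxx Lyx Lyy) {y₀ : Euc ny}
    {β : ℝ} (hσ : 0 < μ + β) {x x' : Euc nx} {y y' : Euc ny} (hx : x ∈ X) (hx' : x' ∈ X)
    (hy : y ∈ Y) (hy' : y' ∈ Y) (hmax : IsMaxOn (regPayoff L y₀ β x) Y y)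
    (hmax' : IsMaxOn (regPayoff L y₀ β x') Y y') :
    regPayoff L y₀ β x' y' ≤ regPayoff L y₀ β x y + inner ℝ (gradX L x y) (x' - x)
      + (Lxx / 2 + Lyx ^ 2 / (μ + β)) * ‖x' - x‖ ^ 2 := by
  -- Linearizing at the new maximizer `y'` and then moving the gradient to `y` avoids
  -- differentiating the maximum; the exchange costs `Lyx * ‖y' - y‖ * ‖x' - x‖`, which is quadratic
  -- in the step.
  have h1 := (abs_le.1 (h.abs_sub_sub_inner_gradX_le hx hx' hy')).2
  have h2 := h.inner_gradX_sub_le hx hy' hy (x' - x)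
  have h3 := h.norm_sub_le_of_isMaxOn hσ le_rfl hx hx' hy hy' le_rfl hmax hmax'
  have h4 : regPayoff L y₀ β x y' ≤ regPayoff L y₀ β x y := hmax hy'
  rw [sub_self, zero_mul, add_zero, norm_sub_rev x, norm_sub_rev y] at h3
  have h5 : Lyx * ‖y' - y‖ * ‖x' - x‖ ≤ Lyx ^ 2 / (μ + β) * ‖x' - x‖ ^ 2 := by
    calc Lyx * ‖y' - y‖ * ‖x' - x‖ ≤ Lyx * (Lyx * ‖x' - x‖ / (μ + β)) * ‖x' - x‖ := by
          have := h.Lyx_pos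
          gcongr
      _ = _ := by ring
  have h6 : regPayoff L y₀ β x' y' - regPayoff L y₀ β x y' = L x' y' - L x y' := by
    unfold regPayoff
    ring
  linarith

/-- One projected gradient step contracts the distance to the maximizer, and the function gap after
the step is quadratic in the distance before it. -/
lemma projected_step (h : MinimaxAssumption X Y L μ Lxx Lyx Lyy) {y₀ : Euc ny} {β : ℝ}
    (hβ : 0 ≤ β) (hσ : 0 < μ + β) {x : Euc nx} {y p y' : Euc ny} (hx : x ∈ X) (hy : y ∈ Y)
    (hy' : y' ∈ Y) (hmax : IsMaxOn (regPayoff L y₀ β x) Y y')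
    (hp : IsPO Y (y + (1 / (Lyy + β)) • gradY (regPayoff L y₀ β) x y) p) :
    ‖p - y'‖ ≤ (Lyy + β) / ((Lyy + β) + (μ + β)) * ‖y - y'‖ ∧
      regPayoff L y₀ β x y' - regPayoff L y₀ β x p ≤ (Lyy + β) / 2 * ‖y - y'‖ ^ 2 := by
  have hl : 0 ≤ Lyy + β := add_nonneg h.Lyy_nonneg hβ
  obtain ⟨hpY, hp⟩ := hp
  have hgrow := h.regPayoff_add_le_of_isMaxOn hx hy' hpY hmax
  rw [h.gradY_regPayoff y₀ β hx hy] at hp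
  have hstep : regPayoff L y₀ β x y' - regPayoff L y₀ β x p
      ≤ ((Lyy + β) - (μ + β)) / 2 * ‖y - y'‖ ^ 2 - (Lyy + β) / 2 * ‖p - y'‖ ^ 2 := by
    rcases hl.eq_or_lt with h0 | h0
    -- Here the step length is the default value `1 / 0 = 0`, but the upper and lower quadratic
    -- bounds are compatible only if `Y` is a single point.
    · have hsub : ∀ u ∈ Y, ‖u - y'‖ = 0 := by
        intro u hu
        have h1 := h.le_regPayoff y₀ β hx hu hy'
        have h2 := h.regPayoff_le y₀ β hx hu hy'
        rw [← h0] at h1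
        have h3 : (μ + β) * ‖y' - u‖ ^ 2 ≤ 0 := by linarith
        have h4 : ‖y' - u‖ ^ 2 = 0 :=
          le_antisymm (nonpos_of_mul_nonpos_right h3 hσ) (sq_nonneg _)
        rw [norm_sub_rev]
        exact pow_eq_zero_iff two_ne_zero |>.1 h4
      have h5 := sub_eq_zero.1 (norm_eq_zero.1 (hsub p hpY))
      rw [hsub y hy, hsub p hpY, h5]
      simp
    · exact sub_le_of_projected_gradient_step h.convex_Y h0 (h.le_regPayoff y₀ β hx hy hpY)
        (h.regPayoff_le y₀ β hx hy hy') hpY hy' hp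
  constructor
  · rw [div_mul_eq_mul_div, le_div_iff₀ (by linarith), ← sq_le_sq₀ (by positivity) (by positivity),
      mul_pow, mul_pow]
    -- Quadratic growth at `p` added to `hstep`. With `l = Lyy + β` and `σ = μ + β`, the stated
    -- factor follows from `(l - σ) * (l + σ) ≤ l ^ 2`.
    have h1 : ((Lyy + β) + (μ + β)) * ‖p - y'‖ ^ 2 ≤ ((Lyy + β) - (μ + β)) * ‖y - y'‖ ^ 2 := by
      linarith
    nlinarith [sq_nonneg ((μ + β) * ‖y - y'‖)]
  · nlinarith [sq_nonneg ‖y - y'‖, sq_nonneg ‖p - y'‖]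

end MinimaxAssumption

/-! ### From the algorithm to scalar recursions. -/

/-- On `Y` the regularization lowers the payoff by an amount between `0` and `β / 2 * D ^ 2`; this
is the bias term of the dual bound. -/
lemma dualGap_le_of_isMaxOn_regPayoff {nx ny : ℕ} {Y : Set (Euc ny)} {L : Euc nx → Euc ny → ℝ}
    {y₀ : Euc ny} {D β : ℝ}
    (hβ : 0 ≤ β) (hD : ∀ u ∈ Y, ‖u - y₀‖ ≤ D) {x : Euc nx} {y y' : Euc ny}
    (hy : y ∈ Y) (hmax : IsMaxOn (regPayoff L y₀ β x) Y y') :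
    dualGap Y L x y ≤ regPayoff L y₀ β x y' - regPayoff L y₀ β x y + β / 2 * D ^ 2 := by
  have h1 : sSup ((fun u => L x u) '' Y) ≤ regPayoff L y₀ β x y' + β / 2 * D ^ 2 := by
    refine csSup_le ⟨_, y, hy, rfl⟩ ?_
    rintro _ ⟨u, hu, rfl⟩
    have h2 : regPayoff L y₀ β x u ≤ regPayoff L y₀ β x y' := hmax hu
    have h3 : ‖u - y₀‖ ^ 2 ≤ D ^ 2 := pow_le_pow_left₀ (norm_nonneg _) (hD u hu) 2
    unfold regPayoff at h2 ⊢
    have := mul_le_mul_of_nonneg_left h3 (by positivity : (0 : ℝ) ≤ β / 2)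
    dsimp only
    linarith
  have h4 : regPayoff L y₀ β x y ≤ L x y := by
    unfold regPayoff
    have : 0 ≤ β / 2 * ‖y - y₀‖ ^ 2 := by positivity
    linarith
  unfold dualGap
  linarith

lemma IsLMO.fwGap_eq {nx ny : ℕ} {X : Set (Euc nx)} {L : Euc nx → Euc ny → ℝ} {x v : Euc nx}
    {y : Euc ny} (hv : IsLMO X (gradX L x y) v) :
    fwGap X L x y = inner ℝ (gradX L x y) (x - v) := by
  refine IsGreatest.csSup_eq ⟨⟨v, hv.1, rfl⟩, ?_⟩
  rintro _ ⟨w, hw, rfl⟩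
  have := hv.2 w hw
  simp only [inner_sub_right]
  linarith

/-- A bound on the gradient is not among the allowed constants, so the gap is controlled by `M`: up
to smoothness errors, a large gap would make `f v` much smaller than `f x`. -/
lemma MinimaxAssumption.fwGap_le {nx ny : ℕ} {X : Set (Euc nx)} {Y : Set (Euc ny)}
    {L : Euc nx → Euc ny → ℝ} {μ Lxx Lyx Lyy DX DY M : ℝ}
    (h : MinimaxAssumption X Y L μ Lxx Lyx Lyy) (hX : Metric.diam X ≤ DX)
    (hY : Metric.diam Y ≤ DY) (hM : ∀ x ∈ X, |primalFun Y L x| ≤ M) {x v : Euc nx} {y : Euc ny}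
    (hx : x ∈ X) (hy : y ∈ Y) (hv : IsLMO X (gradX L x y) v) :
    fwGap X L x y ≤ 2 * M + Lyx * DY * DX + Lxx / 2 * DX ^ 2 := by
  -- With `β = 0` this is a maximizer of `L v` itself; the reference point `y` plays no role.
  obtain ⟨u, hu, hmax⟩ := h.exists_isMaxOn_regPayoff y 0 ⟨y, hy⟩ hv.1
  have h1 : primalFun Y L v ≤ L v u := by
    refine csSup_le ⟨_, y, hy, rfl⟩ ?_
    rintro _ ⟨w, hw, rfl⟩
    simpa [regPayoff] using isMaxOn_iff.1 hmax w hw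
  have h2 := (abs_le.1 (h.abs_sub_sub_inner_gradX_le hx hv.1 hu)).2
  have h3 := h.inner_gradX_sub_le hx hu hy (v - x)
  have h4 := h.le_primalFun hx hu
  have h5 := (abs_le.1 (hM x hx)).2
  have h6 := (abs_le.1 (hM v hv.1)).1
  have hd := norm_sub_le_of_diam_le h.compact_X hX hv.1 hx
  have hDY := norm_sub_le_of_diam_le h.compact_Y hY hu hy
  have h7 : Lyx * ‖u - y‖ * ‖v - x‖ ≤ Lyx * DY * DX := by
    have := h.Lyx_pos
    have := (norm_nonneg _).trans hDY
    gcongr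
  have h8 : Lxx / 2 * ‖v - x‖ ^ 2 ≤ Lxx / 2 * DX ^ 2 := by
    have := h.Lxx_nonneg
    gcongr
  rw [hv.fwGap_eq, ← neg_sub v x, inner_neg_right]
  linarith

lemma IsLMOPO.mem {nx ny : ℕ} {X : Set (Euc nx)} {Y : Set (Euc ny)}
    {L : Euc nx → Euc ny → ℝ} {Lyy : ℝ} {τ β : ℕ → ℝ} {x : ℕ → Euc nx} {y : ℕ → Euc ny}
    (hrun : IsLMOPO X Y L Lyy τ β x y) (hX : Convex ℝ X) (hτ : ∀ t, 0 ≤ τ t ∧ τ t ≤ 1) :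
    ∀ t, x t ∈ X ∧ y t ∈ Y := by
  intro t
  induction t with
  | zero => exact ⟨hrun.init_x, hrun.init_y⟩
  | succ t ih =>
    obtain ⟨v, hv, hxt⟩ := hrun.step_x t
    refine ⟨?_, (hrun.step_y t).1⟩
    rw [hxt]
    exact hX.add_smul_sub_mem ih.1 hv.1 (hτ t)

/-- The scalar recursions satisfied by a run of the algorithm: `e t` is the distance of `y t` to the
maximizer of the regularized payoff, and `φ t` is a shifted regularized primal value. -/
structure GapRecursion (DX DY Lxx Lyx Lyy μ B B' : ℝ) (τ β e φ G H : ℕ → ℝ) : Prop where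
  e_nonneg : ∀ t, 0 ≤ e t
  e_le : ∀ t, e t ≤ DY
  abs_φ_le : ∀ t, |φ t| ≤ B
  G_nonneg : ∀ t, 0 ≤ G t
  G_le : ∀ t, G t ≤ B'
  e_succ : ∀ t, e (t + 1) ≤ (Lyy + β t) / ((Lyy + β t) + (μ + β t)) * e t
    + (Lyx * (τ t * DX) + (β t - β (t + 1)) * DY) / (μ + β t)
  primal : ∀ t, τ t * G t ≤ φ t - φ (t + 1) + Lyx * DX * (τ t * e t)
    + (Lxx / 2 + Lyx ^ 2 / (μ + β t)) * (τ t * DX) ^ 2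
  dual : ∀ t, H (t + 1) ≤ (Lyy + β t) / 2 * e t ^ 2 + Lyx * DX * (τ t * e t)
    + (Lxx + Lyx ^ 2 / (μ + β t)) * (τ t * DX) ^ 2 + β t / 2 * DY ^ 2

/-- All the geometry is used up here; the rates follow from the scalar inequalities and the
parameter sequences. -/
theorem IsLMOPO.exists_gapRecursion {nx ny : ℕ} {X : Set (Euc nx)} {Y : Set (Euc ny)}
    {L : Euc nx → Euc ny → ℝ} {μ Lxx Lyx Lyy DX DY M : ℝ} {τ β : ℕ → ℝ}
    {x : ℕ → Euc nx} {y : ℕ → Euc ny} (hrun : IsLMOPO X Y L Lyy τ β x y)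
    (h : MinimaxAssumption X Y L μ Lxx Lyx Lyy) (hX : Metric.diam X ≤ DX)
    (hY : Metric.diam Y ≤ DY) (hM : ∀ x ∈ X, |primalFun Y L x| ≤ M)
    (hτ : ∀ t, 0 ≤ τ t ∧ τ t ≤ 1) (hβ : ∀ t, 0 ≤ β t) (hanti : Antitone β)
    (hσ : ∀ t, 0 < μ + β t) :
    ∃ e φ : ℕ → ℝ, GapRecursion DX DY Lxx Lyx Lyy μ (M + β 0 / 2 * DY ^ 2)
      (2 * M + Lyx * DY * DX + Lxx / 2 * DX ^ 2) τ β e φ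
      (fun t => fwGap X L (x t) (y t)) (fun t => dualGap Y L (x t) (y t)) := by
  have hmem := hrun.mem h.convex_X hτ
  have hxm := fun t => (hmem t).1
  have hym := fun t => (hmem t).2
  have hdY : ∀ a ∈ Y, ∀ b ∈ Y, ‖a - b‖ ≤ DY := fun a ha b hb =>
    norm_sub_le_of_diam_le h.compact_Y hY ha hb
  have hLyx := h.Lyx_pos
  have hLxx := h.Lxx_nonneg
  choose v hv hstep using hrun.step_x
  choose u huY humax using fun t =>
    h.exists_isMaxOn_regPayoff (y 0) (β t) ⟨y 0, hym 0⟩ (hxm t)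
  have hd : ∀ t, ‖x (t + 1) - x t‖ ≤ τ t * DX := by
    intro t
    rw [hstep t, add_sub_cancel_left, norm_smul, Real.norm_of_nonneg (hτ t).1]
    exact mul_le_mul_of_nonneg_left
      (norm_sub_le_of_diam_le h.compact_X hX (hv t).1 (hxm t)) (hτ t).1
  have hdnn : ∀ t, 0 ≤ τ t * DX := fun t => (norm_nonneg _).trans (hd t)
  have hps := fun t => h.projected_step (hβ t) (hσ t) (hxm t) (hym t) (huY t) (humax t)
    (hrun.step_y t)
  have hq : ∀ t, (Lyy + β t) / ((Lyy + β t) + (μ + β t)) ≤ 1 := fun t => by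
    have := hσ t
    have := h.Lyy_nonneg
    have := hβ t
    rw [div_le_one (by linarith)]
    linarith
  have hcontr : ∀ t, ‖y (t + 1) - u t‖ ≤ ‖y t - u t‖ := fun t =>
    (hps t).1.trans (mul_le_of_le_one_left (norm_nonneg _) (hq t))
  have hC : ∀ t, 0 ≤ Lyx ^ 2 / (μ + β t) := fun t => by
    have := hσ t
    positivity
  have hsmooth : ∀ t, ∀ w ∈ Y, IsMaxOn (regPayoff L (y 0) (β t) (x (t + 1))) Y w →
      regPayoff L (y 0) (β t) (x (t + 1)) w ≤ regPayoff L (y 0) (β t) (x t) (u t)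
        + inner ℝ (gradX L (x t) (u t)) (x (t + 1) - x t)
        + (Lxx / 2 + Lyx ^ 2 / (μ + β t)) * (τ t * DX) ^ 2 := by
    intro t w hw hwmax
    refine (h.regPayoff_sub_le_of_isMaxOn (hσ t) (hxm t) (hxm (t + 1)) (huY t) hw (humax t)
      hwmax).trans ?_
    have := hC t
    have := hd t
    gcongr
  have hcross : ∀ t, Lyx * ‖y t - u t‖ * ‖x (t + 1) - x t‖
      ≤ Lyx * DX * (τ t * ‖y t - u t‖) := by
    intro t
    calc Lyx * ‖y t - u t‖ * ‖x (t + 1) - x t‖ ≤ Lyx * ‖y t - u t‖ * (τ t * DX) := by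
          have := hd t
          gcongr
      _ = _ := by ring
  have hfw : ∀ t, fwGap X L (x t) (y t) = inner ℝ (gradX L (x t) (y t)) (x t - v t) :=
    fun t => (hv t).fwGap_eq
  -- The shift `β t / 2 * DY ^ 2` absorbs the rise of the regularized maximum when `β` decreases.
  refine ⟨fun t => ‖y t - u t‖, fun t => regPayoff L (y 0) (β t) (x t) (u t) + β t / 2 * DY ^ 2,
    fun t => norm_nonneg _, fun t => hdY _ (hym t) _ (huY t), ?_, ?_,
    fun t => h.fwGap_le hX hY hM (hxm t) (hym t) (hv t), ?_, ?_, ?_⟩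
  · intro t
    have h1 := dualGap_le_of_isMaxOn_regPayoff (hβ t) (fun w hw => hdY w hw _ (hym 0)) (huY t)
      (humax t)
    have h2 : dualGap Y L (x t) (u t) = primalFun Y L (x t) - L (x t) (u t) := rfl
    have h3 := h.le_primalFun (hxm t) (huY t)
    have h4 := abs_le.1 (hM _ (hxm t))
    have h5 : β t / 2 * ‖u t - y 0‖ ^ 2 ≤ β t / 2 * DY ^ 2 := by
      have := hβ t
      have := hdY _ (huY t) _ (hym 0)
      gcongr
    have h6 : β t / 2 * DY ^ 2 ≤ β 0 / 2 * DY ^ 2 := by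
      have := hanti (Nat.zero_le t)
      gcongr
    have h7 : 0 ≤ β t / 2 * ‖u t - y 0‖ ^ 2 := by
      have := hβ t
      positivity
    unfold regPayoff at h1 ⊢
    rw [abs_le]
    constructor <;> linarith
  · intro t
    have := (hv t).2 _ (hxm t)
    rw [hfw, inner_sub_right]
    linarith
  · intro t
    have h1 := h.norm_sub_le_of_isMaxOn (hσ t) (hanti t.le_succ) (hxm t) (hxm (t + 1)) (huY t)
      (huY (t + 1)) (hdY _ (huY (t + 1)) _ (hym 0)) (humax t) (humax (t + 1))
    have h2 : (Lyx * ‖x t - x (t + 1)‖ + (β t - β (t + 1)) * DY) / (μ + β t)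
        ≤ (Lyx * (τ t * DX) + (β t - β (t + 1)) * DY) / (μ + β t) := by
      have := hσ t
      have := hd t
      rw [norm_sub_rev]
      gcongr
    have h3 := norm_sub_le_norm_sub_add_norm_sub (y (t + 1)) (u t) (u (t + 1))
    have h4 := (hps t).1
    linarith
  · intro t
    -- The maximizer at the new `x` for the old `β` separates the motion of `x` from the change of
    -- `β`.
    obtain ⟨w, hw, hwmax⟩ :=
      h.exists_isMaxOn_regPayoff (y 0) (β t) ⟨y 0, hym 0⟩ (hxm (t + 1))
    have h1 := hsmooth t w hw hwmax
    have h2 := h.inner_gradX_sub_le (hxm t) (huY t) (hym t) (x (t + 1) - x t)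
    have h3 : inner ℝ (gradX L (x t) (y t)) (x (t + 1) - x t)
        = -(τ t * fwGap X L (x t) (y t)) := by
      rw [hfw, hstep t, add_sub_cancel_left, real_inner_smul_right, ← neg_sub (x t),
        inner_neg_right]
      ring
    have h4 : regPayoff L (y 0) (β t) (x (t + 1)) (u (t + 1))
        ≤ regPayoff L (y 0) (β t) (x (t + 1)) w := hwmax (huY (t + 1))
    have h5 : (β t - β (t + 1)) / 2 * ‖u (t + 1) - y 0‖ ^ 2 ≤ (β t - β (t + 1)) / 2 * DY ^ 2 := by
      have := sub_nonneg.2 (hanti t.le_succ)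
      have := hdY _ (huY (t + 1)) _ (hym 0)
      gcongr
    have h6 : regPayoff L (y 0) (β (t + 1)) (x (t + 1)) (u (t + 1))
        = regPayoff L (y 0) (β t) (x (t + 1)) (u (t + 1))
          + (β t - β (t + 1)) / 2 * ‖u (t + 1) - y 0‖ ^ 2 := by
      unfold regPayoff
      ring
    have h7 := hcross t
    rw [norm_sub_rev (u t)] at h2
    linarith
  · intro t
    obtain ⟨w, hw, hwmax⟩ :=
      h.exists_isMaxOn_regPayoff (y 0) (β t) ⟨y 0, hym 0⟩ (hxm (t + 1))
    have h1 := hsmooth t w hw hwmax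
    -- The maximum changes along `gradX` at `u t`, the value at `y (t + 1)` along `gradX` at `y (t +
    -- 1)`. Only their difference survives, which leaves `τ * e` instead of `τ`.
    have h2 := h.inner_gradX_sub_le (hxm t) (huY t) (hym (t + 1)) (x (t + 1) - x t)
    have h3 := (abs_le.1
      (h.abs_sub_sub_inner_gradX_le (hxm t) (hxm (t + 1)) (hym (t + 1)))).1
    have h4 : Lxx / 2 * ‖x (t + 1) - x t‖ ^ 2 ≤ Lxx / 2 * (τ t * DX) ^ 2 := by
      have := hd t
      gcongr
    have h5 := dualGap_le_of_isMaxOn_regPayoff (hβ t) (fun a ha => hdY a ha _ (hym 0))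
      (hym (t + 1)) hwmax
    have h6 : Lyx * ‖y (t + 1) - u t‖ * ‖x (t + 1) - x t‖
        ≤ Lyx * ‖y t - u t‖ * ‖x (t + 1) - x t‖ := by
      have := hcontr t
      gcongr
    have h7 : regPayoff L (y 0) (β t) (x (t + 1)) (y (t + 1))
        - regPayoff L (y 0) (β t) (x t) (y (t + 1))
        = L (x (t + 1)) (y (t + 1)) - L (x t) (y (t + 1)) := by
      unfold regPayoff
      ring
    have h8 := hcross t
    have h9 := (hps t).2
    rw [norm_sub_rev (u t)] at h2
    linarith

/-! ### Summation estimates. -/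

section Sums

/-- Weighted telescoping with monotone weights. -/
lemma sum_le_of_weighted_descent {w φ g r : ℕ → ℝ} {c B : ℝ} (hw : Monotone w) (hw0 : 0 ≤ w 0)
    (hφ : ∀ t, |φ t| ≤ B) (h : ∀ t, c * g t ≤ w t * (φ t - φ (t + 1)) + r t) (n : ℕ) :
    c * ∑ t ∈ Finset.range n, g t ≤ 2 * B * w n + ∑ t ∈ Finset.range n, r t := by
  -- The stronger form closes the induction: `B - φ` is nonnegative, so raising its weight from `w
  -- n` to `w (n + 1)` only enlarges the bound.
  have key : c * ∑ t ∈ Finset.range n, g t ≤ w n * (B - φ n) + ∑ t ∈ Finset.range n, r t := by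
    induction n with
    | zero =>
      have := (abs_le.1 (hφ 0)).2
      simpa using mul_nonneg hw0 (sub_nonneg.2 this)
    | succ n ih =>
      rw [Finset.sum_range_succ, Finset.sum_range_succ, mul_add]
      have h1 := h n
      have h2 := mul_le_mul_of_nonneg_right (hw n.le_succ)
        (sub_nonneg.2 (abs_le.1 (hφ (n + 1))).2)
      simp only [Nat.succ_eq_add_one] at h2
      linarith
  have h1 : w n * (B - φ n) ≤ w n * (2 * B) :=
    mul_le_mul_of_nonneg_left (by linarith [(abs_le.1 (hφ n)).1])
      (hw0.trans (hw (Nat.zero_le n)))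
  linarith

/-- By Bernoulli's inequality for the exponent `1 - a ≤ 1`, each term is at most the increment of `n
^ (1 - a) / (1 - a)`. -/
lemma sum_rpow_neg_le {a : ℝ} (ha0 : 0 ≤ a) (ha1 : a < 1) (n : ℕ) :
    ∑ t ∈ Finset.range n, ((t : ℝ) + 1) ^ (-a) ≤ (n : ℝ) ^ (1 - a) / (1 - a) := by
  have hb : 0 < 1 - a := by linarith
  induction n with
  | zero => simp [Real.zero_rpow hb.ne']
  | succ n ih =>
    rw [Finset.sum_range_succ]
    have hs : (0 : ℝ) < (n : ℝ) + 1 := by positivity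
    have h1 := rpow_one_add_le_one_add_mul_self (s := -(1 / ((n : ℝ) + 1)))
      (by rw [neg_le_neg_iff, div_le_one hs]; linarith [n.cast_nonneg (α := ℝ)]) hb.le
      (by linarith)
    have h2 : (n : ℝ) = ((n : ℝ) + 1) * (1 + -(1 / ((n : ℝ) + 1))) := by
      field_simp
      ring
    have h3 : (n : ℝ) ^ (1 - a) ≤ ((n : ℝ) + 1) ^ (1 - a) - (1 - a) * ((n : ℝ) + 1) ^ (-a) := by
      have h4 : (0 : ℝ) ≤ 1 + -(1 / ((n : ℝ) + 1)) := by
        have : 1 / ((n : ℝ) + 1) ≤ 1 := by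
          rw [div_le_one hs]
          linarith [n.cast_nonneg (α := ℝ)]
        linarith
      have h5 : ((n : ℝ) + 1) ^ (1 - a) = ((n : ℝ) + 1) * ((n : ℝ) + 1) ^ (-a) := by
        rw [sub_eq_add_neg, Real.rpow_add hs, Real.rpow_one]
      conv_lhs => rw [h2]
      rw [Real.mul_rpow hs.le h4]
      calc _ ≤ ((n : ℝ) + 1) ^ (1 - a) * (1 + (1 - a) * -(1 / ((n : ℝ) + 1))) := by gcongr
        _ = ((n : ℝ) + 1) ^ (1 - a) - (1 - a) * (((n : ℝ) + 1) ^ (1 - a) / ((n : ℝ) + 1)) := by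
          ring
        _ = _ := by rw [h5, mul_div_cancel_left₀ _ hs.ne']
    push_cast
    rw [le_div_iff₀ hb] at ih ⊢
    linarith

lemma sum_one_div_le_one_add_log (n : ℕ) :
    ∑ t ∈ Finset.range n, ((t : ℝ) + 1)⁻¹ ≤ 1 + Real.log n := by
  have := harmonic_le_one_add_log n
  simpa [harmonic] using this

lemma add_one_rpow_le {a b : ℝ} (ha : 0 ≤ a) (hab : a ≤ b) (hb : b ≤ 1) {n : ℕ} (hn : 1 ≤ n) :
    ((n : ℝ) + 1) ^ a ≤ 2 * (n : ℝ) ^ b := by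
  have hn' : (1 : ℝ) ≤ n := by exact_mod_cast hn
  calc ((n : ℝ) + 1) ^ a ≤ (2 * n : ℝ) ^ a := by
        gcongr
        linarith
    _ = 2 ^ a * (n : ℝ) ^ a := Real.mul_rpow two_pos.le (by linarith)
    _ ≤ 2 ^ (1 : ℝ) * (n : ℝ) ^ b := by
        gcongr
        · norm_num
        · linarith
    _ = _ := by rw [Real.rpow_one]

end Sums

/-! ### Uniform bounds from `Θ` asymptotics. -/

section Theta

variable {u : ℕ → ℝ} {a b : ℝ}

lemma one_le_nat_mul_rpow_neg {N t : ℕ} (hb : b ≤ 1) (ht : t < N) :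
    1 ≤ (N : ℝ) * ((t : ℝ) + 1) ^ (-b) := by
  have h1 : (1 : ℝ) ≤ (t : ℝ) + 1 := by linarith [t.cast_nonneg (α := ℝ)]
  have h2 : ((t : ℝ) + 1) ≤ N := by exact_mod_cast ht
  rw [Real.rpow_neg (by linarith), ← div_eq_mul_inv, le_div_iff₀ (by positivity), one_mul]
  exact (Real.rpow_le_rpow_of_exponent_le h1 hb).trans ((Real.rpow_one _).trans_le h2)

/-- The shift to `t + 1` keeps the power positive at `t = 0`; the initial segment is paid for by `B`
through `one_le_nat_mul_rpow_neg`. -/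
lemma exists_forall_le_rpow (ha0 : 0 ≤ a) (ha1 : a ≤ 1) {B : ℝ} (hu : ∀ t, u t ≤ B)
    (h : u =O[atTop] (fun t : ℕ => (t : ℝ) ^ (-a))) :
    ∃ C : ℝ, 0 < C ∧ ∀ t : ℕ, u t ≤ C * ((t : ℝ) + 1) ^ (-a) := by
  obtain ⟨C, hC, hbound⟩ := h.exists_pos
  obtain ⟨N, hN⟩ := eventually_atTop.1 hbound.bound
  refine ⟨2 * C + |B| * (N + 1 : ℕ), by positivity, fun t => ?_⟩
  have hs : (0 : ℝ) < ((t : ℝ) + 1) ^ (-a) := by positivity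
  rw [add_mul]
  by_cases ht : t < N + 1
  · have h1 := one_le_nat_mul_rpow_neg (b := a) ha1 ht
    have h2 : |B| * 1 ≤ |B| * ((N + 1 : ℕ) * ((t : ℝ) + 1) ^ (-a)) := by gcongr
    have h3 := (hu t).trans (le_abs_self B)
    have : 0 ≤ 2 * C * ((t : ℝ) + 1) ^ (-a) := by positivity
    linarith
  · push Not at ht
    have ht1 : (1 : ℝ) ≤ t := by exact_mod_cast (by omega : 1 ≤ t)
    have h1 := (le_abs_self _).trans (hN t (by omega))
    rw [Real.norm_of_nonneg (by positivity)] at h1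
    have h2 : (t : ℝ) ^ (-a) ≤ 2 * ((t : ℝ) + 1) ^ (-a) := by
      rw [Real.rpow_neg (by linarith), Real.rpow_neg (by linarith), ← div_eq_mul_inv,
        inv_eq_one_div, div_le_div_iff₀ (by positivity) (by positivity), one_mul]
      exact add_one_rpow_le ha0 le_rfl ha1 (by omega)
    have h3 : C * (t : ℝ) ^ (-a) ≤ C * (2 * ((t : ℝ) + 1) ^ (-a)) := by gcongr
    have : 0 ≤ |B| * (N + 1 : ℕ) * ((t : ℝ) + 1) ^ (-a) := by positivity
    linarith

lemma exists_eventually_rpow_le (ha : 0 ≤ a) (hu : ∀ t, 0 ≤ u t)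
    (h : (fun t : ℕ => (t : ℝ) ^ (-a)) =O[atTop] u) :
    ∃ C : ℝ, 0 < C ∧ ∃ N : ℕ, ∀ t ≥ N, ((t : ℝ) + 1) ^ (-a) ≤ C * u t := by
  obtain ⟨C, hC, hbound⟩ := h.exists_pos
  obtain ⟨N, hN⟩ := eventually_atTop.1 hbound.bound
  refine ⟨C, hC, N + 1, fun t ht => ?_⟩
  have ht1 : (1 : ℝ) ≤ t := by exact_mod_cast (by omega : 1 ≤ t)
  have h1 := hN t (by omega)
  rw [Real.norm_of_nonneg (by positivity), Real.norm_of_nonneg (hu t)] at h1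
  exact (Real.rpow_le_rpow_of_nonpos (by linarith) (by linarith) (by linarith)).trans h1

/-- A substitute for `1 / u t = O(t ^ a)`, as finitely many stepsizes may vanish: the term with `N`
covers those indices and is small when summed. -/
lemma exists_forall_one_le (ha : 0 ≤ a) (hb : b ≤ 1) (hu : ∀ t, 0 ≤ u t)
    (h : (fun t : ℕ => (t : ℝ) ^ (-a)) =O[atTop] u) :
    ∃ C N : ℝ, 0 < C ∧ 0 ≤ N ∧
      ∀ t : ℕ, 1 ≤ C * ((t : ℝ) + 1) ^ a * u t + N * ((t : ℝ) + 1) ^ (-b) := by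
  obtain ⟨C, hC, N, hN⟩ := exists_eventually_rpow_le ha hu h
  refine ⟨C, N, hC, N.cast_nonneg, fun t => ?_⟩
  have hs : (0 : ℝ) < (t : ℝ) + 1 := by positivity
  by_cases ht : t < N
  · have h1 := one_le_nat_mul_rpow_neg hb ht
    have : 0 ≤ C * ((t : ℝ) + 1) ^ a * u t := mul_nonneg (by positivity) (hu t)
    linarith
  · have h1 := hN t (by omega)
    have h2 : ((t : ℝ) + 1) ^ a * ((t : ℝ) + 1) ^ (-a) = 1 := by
      rw [← Real.rpow_add hs, add_neg_cancel, Real.rpow_zero]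
    have h3 := mul_le_mul_of_nonneg_left h1 (Real.rpow_nonneg hs.le a)
    have : 0 ≤ (N : ℝ) * ((t : ℝ) + 1) ^ (-b) := by positivity
    linarith

/-- No correction term is needed here, since monotonicity gives `u t ≥ u N > 0` on the initial
segment. -/
lemma exists_forall_rpow_le_of_antitone (ha : 0 ≤ a) (hu : ∀ t, 0 < u t) (hanti : Antitone u)
    (h : (fun t : ℕ => (t : ℝ) ^ (-a)) =O[atTop] u) :
    ∃ C : ℝ, 0 < C ∧ ∀ t : ℕ, ((t : ℝ) + 1) ^ (-a) ≤ C * u t := by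
  obtain ⟨C, hC, N, hN⟩ := exists_eventually_rpow_le ha (fun t => (hu t).le) h
  have huN := hu N
  refine ⟨C + 1 / u N, by positivity, fun t => ?_⟩
  rw [add_mul]
  by_cases ht : N ≤ t
  · have h1 := hN t ht
    have : 0 ≤ 1 / u N * u t := mul_nonneg (by positivity) (hu t).le
    linarith
  · have h1 : ((t : ℝ) + 1) ^ (-a) ≤ 1 :=
      Real.rpow_le_one_of_one_le_of_nonpos (by linarith [t.cast_nonneg (α := ℝ)]) (by linarith)
    have h2 : 1 ≤ 1 / u N * u t := by
      rw [one_div_mul_eq_div, le_div_iff₀ huN, one_mul]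
      exact hanti (by omega)
    have := mul_nonneg hC.le (hu t).le
    linarith

end Theta

/-! ### Rates in the concave case. -/

namespace GapRecursion

variable {DX DY Lxx Lyx Lyy μ B B' : ℝ} {τ β e φ G H : ℕ → ℝ}

lemma abs_e_le (h : GapRecursion DX DY Lxx Lyx Lyy μ B B' τ β e φ G H) (t : ℕ) : |e t| ≤ DY := by
  rw [abs_of_nonneg (h.e_nonneg t)]
  exact h.e_le t

/-- The summed distance to the regularized maximizer, in the merely concave case. -/
lemma sum_e_le_of_concave (h : GapRecursion DX DY Lxx Lyx Lyy μ B B' τ β e φ G H) {C Cb : ℝ}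
    (hμ : 0 ≤ μ) (hLyx : 0 ≤ Lyx) (hLyy : 0 ≤ Lyy) (hDX : 0 ≤ DX) (hC : 0 < C) (hCb : 0 < Cb)
    (hτ : ∀ t : ℕ, τ t ≤ C * ((t : ℝ) + 1) ^ (-(3 / 4) : ℝ))
    (hβ : ∀ t, 0 < β t) (hanti : Antitone β)
    (hβlow : ∀ t : ℕ, ((t : ℝ) + 1) ^ (-(1 / 4) : ℝ) ≤ Cb * β t) {n : ℕ} (hn : 1 ≤ n) :
    ∑ t ∈ Finset.range n, e t ≤ Cb * (Lyy + μ + 2 * β 0)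
      * (4 * DY + Cb * Lyx * DX * C * (4 / 3) + 4 * (Cb * DY) * β 0) * (n : ℝ) ^ (3 / 4 : ℝ) := by
  set A := Lyy + μ + 2 * β 0 with hA
  have hA0 : 0 < A := by linarith [hβ 0]
  have hDY : 0 ≤ DY := (h.e_nonneg 0).trans (h.e_le 0)
  have hdecr : ∀ t, 0 ≤ β t - β (t + 1) := fun t => sub_nonneg.2 (hanti t.le_succ)
  -- The contraction margin is at least `β t / A`. The weight `(t + 1) ^ (1 / 4)` is at least a
  -- multiple of `1 / β t` and makes the gain constant; the drift of `x` becomes `t^(1/4 + 1/4 -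
  -- 3/4)`.
  have hpt : ∀ t : ℕ, (1 / (Cb * A)) * e t ≤ ((t : ℝ) + 1) ^ (1 / 4 : ℝ) * (e t - e (t + 1))
      + (Cb * Lyx * DX * C * ((t : ℝ) + 1) ^ (-(1 / 4) : ℝ)
        + Cb * DY * (((t : ℝ) + 1) ^ (1 / 2 : ℝ) * (β t - β (t + 1)))) := by
    intro t
    have hs : (0 : ℝ) < (t : ℝ) + 1 := by positivity
    have hβt := hβ t
    have hβ0 : β t ≤ β 0 := hanti (Nat.zero_le t)
    have he := h.e_nonneg t
    have r1 : ((t : ℝ) + 1) ^ (1 / 4 : ℝ) * ((t : ℝ) + 1) ^ (-(1 / 4) : ℝ) = 1 := by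
      rw [← Real.rpow_add hs]
      norm_num
    have r2 : ((t : ℝ) + 1) ^ (1 / 4 : ℝ) * ((t : ℝ) + 1) ^ (1 / 4 : ℝ)
        = ((t : ℝ) + 1) ^ (1 / 2 : ℝ) := by
      rw [← Real.rpow_add hs]
      norm_num
    have r3 : ((t : ℝ) + 1) ^ (1 / 2 : ℝ) * ((t : ℝ) + 1) ^ (-(3 / 4) : ℝ)
        = ((t : ℝ) + 1) ^ (-(1 / 4) : ℝ) := by
      rw [← Real.rpow_add hs]
      norm_num
    set w := ((t : ℝ) + 1) ^ (1 / 4 : ℝ) with hw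
    have hw0 : 0 < w := by positivity
    have hwβ : 1 ≤ Cb * (w * β t) := by
      have := mul_le_mul_of_nonneg_left (hβlow t) hw0.le
      linarith
    have hinv : 1 / β t ≤ Cb * w := by
      rw [div_le_iff₀ hβt]
      linarith
    set p := Lyx * (τ t * DX) + (β t - β (t + 1)) * DY with hp
    have hp1 : p ≤ Lyx * DX * C * ((t : ℝ) + 1) ^ (-(3 / 4) : ℝ) + DY * (β t - β (t + 1)) := by
      have := mul_le_mul_of_nonneg_left (hτ t) (mul_nonneg hLyx hDX)
      linarith
    have hp2 : 0 ≤ Lyx * DX * C * ((t : ℝ) + 1) ^ (-(3 / 4) : ℝ) + DY * (β t - β (t + 1)) := by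
      have := hdecr t
      positivity
    have hpσ : p / (μ + β t)
        ≤ (Lyx * DX * C * ((t : ℝ) + 1) ^ (-(3 / 4) : ℝ) + DY * (β t - β (t + 1))) * (Cb * w) := by
      calc p / (μ + β t)
          ≤ (Lyx * DX * C * ((t : ℝ) + 1) ^ (-(3 / 4) : ℝ) + DY * (β t - β (t + 1)))
            / (μ + β t) := by gcongr
        _ ≤ (Lyx * DX * C * ((t : ℝ) + 1) ^ (-(3 / 4) : ℝ) + DY * (β t - β (t + 1)))
            / β t := by
          gcongr
          linarith
        _ ≤ _ := by
          rw [div_eq_mul_one_div]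
          gcongr
    have hq : (Lyy + β t) / ((Lyy + β t) + (μ + β t)) ≤ 1 - β t / A := by
      have hd : 0 < (Lyy + β t) + (μ + β t) := by linarith
      have h1 : β t / A ≤ (μ + β t) / ((Lyy + β t) + (μ + β t)) := by
        gcongr <;> linarith
      have h2 : (Lyy + β t) / ((Lyy + β t) + (μ + β t))
          + (μ + β t) / ((Lyy + β t) + (μ + β t)) = 1 := by
        rw [← add_div, div_self hd.ne']
      linarith
    have h1 : β t / A * e t ≤ e t - e (t + 1)
        + (Lyx * DX * C * ((t : ℝ) + 1) ^ (-(3 / 4) : ℝ) + DY * (β t - β (t + 1))) * (Cb * w) := by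
      have := h.e_succ t
      have := mul_le_mul_of_nonneg_right hq he
      linarith
    have h2 : 1 / (Cb * A) * e t ≤ w * (β t / A * e t) := by
      rw [← mul_assoc]
      gcongr
      rw [← mul_div_assoc, div_le_div_iff₀ (by positivity) hA0, one_mul]
      calc A = 1 * A := (one_mul A).symm
        _ ≤ Cb * (w * β t) * A := by gcongr
        _ = _ := by ring
    have h3 := mul_le_mul_of_nonneg_left h1 hw0.le
    refine (h2.trans h3).trans_eq ?_
    rw [← r3, ← r2]
    ring
  have hw : ∀ {a : ℝ}, 0 ≤ a → Monotone (fun t : ℕ => ((t : ℝ) + 1) ^ a) := by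
    intro a ha i j hij
    have : (i : ℝ) ≤ j := by exact_mod_cast hij
    dsimp only
    gcongr
  have h1 := sum_le_of_weighted_descent (w := fun t : ℕ => ((t : ℝ) + 1) ^ (1 / 4 : ℝ))
    (hw (by norm_num)) (by positivity) h.abs_e_le hpt n
  rw [Finset.sum_add_distrib, ← Finset.mul_sum, ← Finset.mul_sum] at h1
  -- Weighted telescoping again, with `β` itself as the potential: no rate for the individual
  -- differences of `β` is available.
  have h2 := sum_le_of_weighted_descent (w := fun t : ℕ => ((t : ℝ) + 1) ^ (1 / 2 : ℝ)) (c := 1)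
    (g := fun t : ℕ => ((t : ℝ) + 1) ^ (1 / 2 : ℝ) * (β t - β (t + 1))) (r := fun _ => 0)
    (φ := β) (B := β 0) (hw (by norm_num)) (by positivity)
    (fun t => by
      rw [abs_of_pos (hβ t)]
      exact hanti (Nat.zero_le t)) (fun t => by simp) n
  have h3 := sum_rpow_neg_le (a := 1 / 4) (by norm_num) (by norm_num) n
  rw [show (1 : ℝ) - 1 / 4 = 3 / 4 by norm_num] at h3
  have h4 := add_one_rpow_le (a := 1 / 4) (b := 3 / 4) (by norm_num) (by norm_num) (by norm_num) hn
  have h5 := add_one_rpow_le (a := 1 / 2) (b := 3 / 4) (by norm_num) (by norm_num) (by norm_num) hn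
  simp only [one_mul, Finset.sum_const_zero, add_zero] at h2
  have h6 : 1 / (Cb * A) * ∑ t ∈ Finset.range n, e t
      ≤ (4 * DY + Cb * Lyx * DX * C * (4 / 3) + 4 * (Cb * DY) * β 0) * (n : ℝ) ^ (3 / 4 : ℝ) := by
    have h7 := mul_le_mul_of_nonneg_left h4 (mul_nonneg two_pos.le hDY)
    have h8 := mul_le_mul_of_nonneg_left h3
      (by positivity : 0 ≤ Cb * Lyx * DX * C)
    have h9 := mul_le_mul_of_nonneg_left
      (h2.trans (mul_le_mul_of_nonneg_left h5 (mul_nonneg two_pos.le (hβ 0).le)))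
      (by positivity : 0 ≤ Cb * DY)
    linarith
  rw [one_div_mul_eq_div, div_le_iff₀ (by positivity)] at h6
  linarith

/-- Division by `τ` is multiplication by the increasing weight `C₁ * (t + 1) ^ (3 / 4)`, hence
weighted telescoping. The curvature term becomes `t^(3/4 + 1/4 - 3/2) = t^(-1/2)`. -/
lemma sum_primal_le_of_concave (h : GapRecursion DX DY Lxx Lyx Lyy μ B B' τ β e φ G H)
    {C Cb C₁ N S : ℝ} (hμ : 0 ≤ μ) (hLxx : 0 ≤ Lxx) (hLyx : 0 ≤ Lyx) (hDX : 0 ≤ DX) (hC : 0 < C)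
    (hCb : 0 < Cb) (hC₁ : 0 < C₁) (hN : 0 ≤ N) (hτ0 : ∀ t, 0 ≤ τ t)
    (hτ : ∀ t : ℕ, τ t ≤ C * ((t : ℝ) + 1) ^ (-(3 / 4) : ℝ))
    (hτlow : ∀ t : ℕ, 1 ≤ C₁ * ((t : ℝ) + 1) ^ (3 / 4 : ℝ) * τ t
      + N * ((t : ℝ) + 1) ^ (-(1 / 2) : ℝ))
    (hβ : ∀ t, 0 < β t)
    (hβlow : ∀ t : ℕ, ((t : ℝ) + 1) ^ (-(1 / 4) : ℝ) ≤ Cb * β t) {n : ℕ} (hn : 1 ≤ n)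
    (hS : ∑ t ∈ Finset.range n, e t ≤ S * (n : ℝ) ^ (3 / 4 : ℝ)) :
    ∑ t ∈ Finset.range n, G t ≤ (4 * B * C₁ + C₁ * (Lyx * DX * C) * S
      + 2 * (C₁ * ((Lxx / 2 + Lyx ^ 2 * Cb) * DX ^ 2 * C ^ 2) + N * B')) * (n : ℝ) ^ (3 / 4 : ℝ) := by
  have hB : 0 ≤ B := (abs_nonneg _).trans (h.abs_φ_le 0)
  have hB' : 0 ≤ B' := (h.G_nonneg 0).trans (h.G_le 0)
  have hpt : ∀ t : ℕ, 1 * G t ≤ C₁ * ((t : ℝ) + 1) ^ (3 / 4 : ℝ) * (φ t - φ (t + 1))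
      + (C₁ * (Lyx * DX * C) * e t
        + (C₁ * ((Lxx / 2 + Lyx ^ 2 * Cb) * DX ^ 2 * C ^ 2) + N * B')
          * ((t : ℝ) + 1) ^ (-(1 / 2) : ℝ)) := by
    intro t
    have hs : (0 : ℝ) < (t : ℝ) + 1 := by positivity
    have hs1 : (1 : ℝ) ≤ (t : ℝ) + 1 := by linarith [t.cast_nonneg (α := ℝ)]
    have hβt := hβ t
    have he := h.e_nonneg t
    have hτt := hτ0 t
    have hGt := h.G_nonneg t
    have r1 : ((t : ℝ) + 1) ^ (3 / 4 : ℝ) * ((t : ℝ) + 1) ^ (-(3 / 4) : ℝ) = 1 := by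
      rw [← Real.rpow_add hs]
      norm_num
    have r2 : ((t : ℝ) + 1) ^ (1 / 4 : ℝ) * ((t : ℝ) + 1) ^ (-(1 / 4) : ℝ) = 1 := by
      rw [← Real.rpow_add hs]
      norm_num
    have r3 : ((t : ℝ) + 1) ^ (1 / 4 : ℝ) * ((t : ℝ) + 1) ^ (-(3 / 4) : ℝ)
        = ((t : ℝ) + 1) ^ (-(1 / 2) : ℝ) := by
      rw [← Real.rpow_add hs]
      norm_num
    set w := ((t : ℝ) + 1) ^ (3 / 4 : ℝ) with hw
    set v := ((t : ℝ) + 1) ^ (1 / 4 : ℝ) with hv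
    have hv1 : 1 ≤ v := Real.one_le_rpow hs1 (by norm_num)
    have hw0 : 0 < w := by positivity
    have hwτ : w * τ t ≤ C := by
      have := mul_le_mul_of_nonneg_left (hτ t) hw0.le
      rwa [mul_left_comm, r1, mul_one] at this
    have hinv : 1 / (μ + β t) ≤ Cb * v := by
      rw [div_le_iff₀ (by linarith)]
      have h1 := mul_le_mul_of_nonneg_left (hβlow t) (by linarith : 0 ≤ v)
      have h2 : 0 ≤ Cb * v * μ := by positivity
      linarith
    have hcoef : Lxx / 2 + Lyx ^ 2 / (μ + β t) ≤ (Lxx / 2 + Lyx ^ 2 * Cb) * v := by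
      have h1 : Lyx ^ 2 / (μ + β t) ≤ Lyx ^ 2 * (Cb * v) := by
        rw [div_eq_mul_one_div]
        gcongr
      have h2 : Lxx / 2 * 1 ≤ Lxx / 2 * v := by gcongr
      linarith
    have hquad : w * ((Lxx / 2 + Lyx ^ 2 / (μ + β t)) * (τ t * DX) ^ 2)
        ≤ (Lxx / 2 + Lyx ^ 2 * Cb) * DX ^ 2 * C ^ 2 * ((t : ℝ) + 1) ^ (-(1 / 2) : ℝ) := by
      calc w * ((Lxx / 2 + Lyx ^ 2 / (μ + β t)) * (τ t * DX) ^ 2)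
          ≤ w * ((Lxx / 2 + Lyx ^ 2 * Cb) * v * (τ t * DX) ^ 2) := by gcongr
        _ = (Lxx / 2 + Lyx ^ 2 * Cb) * DX ^ 2 * v * ((w * τ t) * τ t) := by ring
        _ ≤ (Lxx / 2 + Lyx ^ 2 * Cb) * DX ^ 2 * v
            * (C * (C * ((t : ℝ) + 1) ^ (-(3 / 4) : ℝ))) := by
          have := hτ t
          gcongr
        _ = _ := by
          rw [← r3]
          ring
    have hlin : w * (Lyx * DX * (τ t * e t)) ≤ Lyx * DX * C * e t := by
      calc w * (Lyx * DX * (τ t * e t)) = Lyx * DX * (w * τ t) * e t := by ring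
        _ ≤ _ := by gcongr
    -- Where `τ t` is too small for the weight, the a priori bound `G t ≤ B'` takes over.
    have h1 : G t ≤ C₁ * (w * (τ t * G t)) + N * B' * ((t : ℝ) + 1) ^ (-(1 / 2) : ℝ) := by
      have h2 := mul_le_mul_of_nonneg_right (hτlow t) hGt
      have h3 : N * ((t : ℝ) + 1) ^ (-(1 / 2) : ℝ) * G t
          ≤ N * ((t : ℝ) + 1) ^ (-(1 / 2) : ℝ) * B' := by
        have := h.G_le t
        gcongr
      linarith
    have h4 := mul_le_mul_of_nonneg_left (h.primal t) hw0.le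
    have h5 : w * (τ t * G t) ≤ w * (φ t - φ (t + 1)) + Lyx * DX * C * e t
        + (Lxx / 2 + Lyx ^ 2 * Cb) * DX ^ 2 * C ^ 2 * ((t : ℝ) + 1) ^ (-(1 / 2) : ℝ) := by
      linarith
    have h6 := mul_le_mul_of_nonneg_left h5 hC₁.le
    linarith
  have hw : Monotone (fun t : ℕ => C₁ * ((t : ℝ) + 1) ^ (3 / 4 : ℝ)) := by
    intro i j hij
    have : (i : ℝ) ≤ j := by exact_mod_cast hij
    dsimp only
    gcongr
  have h1 := sum_le_of_weighted_descent hw (by positivity) h.abs_φ_le hpt n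
  rw [Finset.sum_add_distrib, ← Finset.mul_sum, ← Finset.mul_sum] at h1
  have h3 := sum_rpow_neg_le (a := 1 / 2) (by norm_num) (by norm_num) n
  rw [show (1 : ℝ) - 1 / 2 = 1 / 2 by norm_num] at h3
  have hn1 : (1 : ℝ) ≤ n := by exact_mod_cast hn
  have h4 : (n : ℝ) ^ (1 / 2 : ℝ) ≤ (n : ℝ) ^ (3 / 4 : ℝ) :=
    Real.rpow_le_rpow_of_exponent_le hn1 (by norm_num)
  have h5 := add_one_rpow_le (a := 3 / 4) (b := 3 / 4) (by norm_num) (by norm_num) (by norm_num) hn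
  have h6 := mul_le_mul_of_nonneg_left hS (by positivity : 0 ≤ C₁ * (Lyx * DX * C))
  have h7 := mul_le_mul_of_nonneg_left
    (h3.trans (by linarith : (n : ℝ) ^ (1 / 2 : ℝ) / (1 / 2) ≤ 2 * (n : ℝ) ^ (3 / 4 : ℝ)))
    (by positivity : 0 ≤ C₁ * ((Lxx / 2 + Lyx ^ 2 * Cb) * DX ^ 2 * C ^ 2) + N * B')
  have h8 := mul_le_mul_of_nonneg_left h5 (by positivity : 0 ≤ 2 * B * C₁)
  linarith

/-- The crude bound `e ^ 2 ≤ DY * e` suffices, since the bias already sums to order `n ^ (3 / 4)`.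
-/
lemma sum_dual_le_of_concave (h : GapRecursion DX DY Lxx Lyx Lyy μ B B' τ β e φ G H)
    {C Cb C₂ S : ℝ} (hμ : 0 ≤ μ) (hLxx : 0 ≤ Lxx) (hLyx : 0 ≤ Lyx) (hLyy : 0 ≤ Lyy) (hDX : 0 ≤ DX)
    (hC : 0 < C) (hCb : 0 < Cb) (hC₂ : 0 < C₂) (hτ01 : ∀ t, 0 ≤ τ t ∧ τ t ≤ 1)
    (hτ : ∀ t : ℕ, τ t ≤ C * ((t : ℝ) + 1) ^ (-(3 / 4) : ℝ))
    (hβ : ∀ t, 0 < β t) (hanti : Antitone β)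
    (hβlow : ∀ t : ℕ, ((t : ℝ) + 1) ^ (-(1 / 4) : ℝ) ≤ Cb * β t)
    (hβup : ∀ t : ℕ, β t ≤ C₂ * ((t : ℝ) + 1) ^ (-(1 / 4) : ℝ)) {n : ℕ}
    (hS : ∑ t ∈ Finset.range n, e t ≤ S * (n : ℝ) ^ (3 / 4 : ℝ)) :
    ∑ t ∈ Finset.range n, H (t + 1) ≤ (((Lyy + β 0) / 2 * DY + Lyx * DX) * S
      + ((Lxx + Lyx ^ 2 * Cb) * DX ^ 2 * C ^ 2 + C₂ / 2 * DY ^ 2) * (4 / 3))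
        * (n : ℝ) ^ (3 / 4 : ℝ) := by
  have hDY : 0 ≤ DY := (h.e_nonneg 0).trans (h.e_le 0)
  have hpt : ∀ t : ℕ, H (t + 1) ≤ ((Lyy + β 0) / 2 * DY + Lyx * DX) * e t
      + ((Lxx + Lyx ^ 2 * Cb) * DX ^ 2 * C ^ 2 + C₂ / 2 * DY ^ 2)
        * ((t : ℝ) + 1) ^ (-(1 / 4) : ℝ) := by
    intro t
    have hs : (0 : ℝ) < (t : ℝ) + 1 := by positivity
    have hs1 : (1 : ℝ) ≤ (t : ℝ) + 1 := by linarith [t.cast_nonneg (α := ℝ)]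
    have hβt := hβ t
    have he := h.e_nonneg t
    obtain ⟨hτt, hτ1⟩ := hτ01 t
    have r2 : ((t : ℝ) + 1) ^ (1 / 4 : ℝ) * ((t : ℝ) + 1) ^ (-(1 / 4) : ℝ) = 1 := by
      rw [← Real.rpow_add hs]
      norm_num
    have r3 : ((t : ℝ) + 1) ^ (1 / 4 : ℝ) * (((t : ℝ) + 1) ^ (-(3 / 4) : ℝ)) ^ 2
        ≤ ((t : ℝ) + 1) ^ (-(1 / 4) : ℝ) := by
      rw [← Real.rpow_natCast, ← Real.rpow_mul hs.le, ← Real.rpow_add hs]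
      exact Real.rpow_le_rpow_of_exponent_le hs1 (by norm_num)
    set v := ((t : ℝ) + 1) ^ (1 / 4 : ℝ) with hv
    have hv1 : 1 ≤ v := Real.one_le_rpow hs1 (by norm_num)
    have hinv : 1 / (μ + β t) ≤ Cb * v := by
      rw [div_le_iff₀ (by linarith)]
      have h1 := mul_le_mul_of_nonneg_left (hβlow t) (by linarith : 0 ≤ v)
      have h2 : 0 ≤ Cb * v * μ := by positivity
      linarith
    have hcoef : Lxx + Lyx ^ 2 / (μ + β t) ≤ (Lxx + Lyx ^ 2 * Cb) * v := by
      have h1 : Lyx ^ 2 / (μ + β t) ≤ Lyx ^ 2 * (Cb * v) := by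
        rw [div_eq_mul_one_div]
        gcongr
      have h2 : Lxx * 1 ≤ Lxx * v := by gcongr
      linarith
    have hquad : (Lxx + Lyx ^ 2 / (μ + β t)) * (τ t * DX) ^ 2
        ≤ (Lxx + Lyx ^ 2 * Cb) * DX ^ 2 * C ^ 2 * ((t : ℝ) + 1) ^ (-(1 / 4) : ℝ) := by
      calc (Lxx + Lyx ^ 2 / (μ + β t)) * (τ t * DX) ^ 2
          ≤ (Lxx + Lyx ^ 2 * Cb) * v
            * (C * ((t : ℝ) + 1) ^ (-(3 / 4) : ℝ) * DX) ^ 2 := by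
            have := hτ t
            gcongr
        _ = (Lxx + Lyx ^ 2 * Cb) * DX ^ 2 * C ^ 2
            * (v * (((t : ℝ) + 1) ^ (-(3 / 4) : ℝ)) ^ 2) := by ring
        _ ≤ _ := by gcongr
    have h1 : (Lyy + β t) / 2 * e t ^ 2 ≤ (Lyy + β 0) / 2 * DY * e t := by
      have h2 : β t ≤ β 0 := hanti (Nat.zero_le t)
      have h3 := h.e_le t
      have h4 := hβ 0
      calc (Lyy + β t) / 2 * e t ^ 2 = (Lyy + β t) / 2 * e t * e t := by ring
        _ ≤ _ := by gcongr
    have h4 : Lyx * DX * (τ t * e t) ≤ Lyx * DX * e t := by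
      gcongr
      exact mul_le_of_le_one_left he hτ1
    have h5 : β t / 2 * DY ^ 2 ≤ C₂ / 2 * DY ^ 2 * ((t : ℝ) + 1) ^ (-(1 / 4) : ℝ) := by
      have := mul_le_mul_of_nonneg_right (hβup t) (sq_nonneg DY)
      linarith
    have h6 := h.dual t
    linarith
  refine (Finset.sum_le_sum fun t _ => hpt t).trans ?_
  rw [Finset.sum_add_distrib, ← Finset.mul_sum, ← Finset.mul_sum]
  have h3 := sum_rpow_neg_le (a := 1 / 4) (by norm_num) (by norm_num) n
  rw [show (1 : ℝ) - 1 / 4 = 3 / 4 by norm_num] at h3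
  have hβ0 := hβ 0
  have h6 := mul_le_mul_of_nonneg_left hS
    (by positivity : 0 ≤ (Lyy + β 0) / 2 * DY + Lyx * DX)
  have h7 := mul_le_mul_of_nonneg_left h3
    (by positivity : 0 ≤ (Lxx + Lyx ^ 2 * Cb) * DX ^ 2 * C ^ 2 + C₂ / 2 * DY ^ 2)
  linarith

end GapRecursion

/-! ### Rates in the strongly concave case. -/

namespace GapRecursion

variable {DX DY Lxx Lyx Lyy μ B B' : ℝ} {τ e φ G H : ℕ → ℝ}

lemma e_succ_of_strongly_concave
    (h : GapRecursion DX DY Lxx Lyx Lyy μ B B' τ (fun _ => 0) e φ G H) {C : ℝ}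
    (hμ : 0 < μ) (hLyx : 0 ≤ Lyx) (hDX : 0 ≤ DX)
    (hτ : ∀ t : ℕ, τ t ≤ C * ((t : ℝ) + 1) ^ (-(1 / 2) : ℝ)) (t : ℕ) :
    e (t + 1) ≤ Lyy / (Lyy + μ) * e t + Lyx * DX * C / μ * ((t : ℝ) + 1) ^ (-(1 / 2) : ℝ) := by
  have h1 := h.e_succ t
  simp only [add_zero, sub_self, zero_mul] at h1
  have h2 : Lyx * (τ t * DX) / μ ≤ Lyx * DX * C / μ * ((t : ℝ) + 1) ^ (-(1 / 2) : ℝ) := by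
    calc Lyx * (τ t * DX) / μ
        ≤ Lyx * (C * ((t : ℝ) + 1) ^ (-(1 / 2) : ℝ) * DX) / μ := by
          have := hτ t
          gcongr
      _ = _ := by ring
  linarith

lemma sum_e_le_of_strongly_concave
    (h : GapRecursion DX DY Lxx Lyx Lyy μ B B' τ (fun _ => 0) e φ G H) {C : ℝ}
    (hμ : 0 < μ) (hLyx : 0 ≤ Lyx) (hLyy : 0 ≤ Lyy) (hDX : 0 ≤ DX) (hC : 0 < C)
    (hτ : ∀ t : ℕ, τ t ≤ C * ((t : ℝ) + 1) ^ (-(1 / 2) : ℝ)) {n : ℕ} (hn : 1 ≤ n) :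
    ∑ t ∈ Finset.range n, e t ≤ (Lyy + μ) / μ * (2 * DY + 2 * (Lyx * DX * C / μ))
      * (n : ℝ) ^ (1 / 2 : ℝ) := by
  have hDY : 0 ≤ DY := (h.e_nonneg 0).trans (h.e_le 0)
  have hpt : ∀ t : ℕ, μ / (Lyy + μ) * e t ≤ 1 * (e t - e (t + 1))
      + Lyx * DX * C / μ * ((t : ℝ) + 1) ^ (-(1 / 2) : ℝ) := by
    intro t
    have h1 := h.e_succ_of_strongly_concave hμ hLyx hDX hτ t
    have h2 : Lyy / (Lyy + μ) + μ / (Lyy + μ) = 1 := by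
      rw [← add_div, div_self (by linarith)]
    have h3 : Lyy / (Lyy + μ) * e t + μ / (Lyy + μ) * e t = e t := by
      rw [← add_mul, h2, one_mul]
    linarith
  have h1 := sum_le_of_weighted_descent (w := fun _ => 1) monotone_const zero_le_one h.abs_e_le hpt n
  rw [← Finset.mul_sum] at h1
  have h3 := sum_rpow_neg_le (a := 1 / 2) (by norm_num) (by norm_num) n
  rw [show (1 : ℝ) - 1 / 2 = 1 / 2 by norm_num] at h3
  have h4 := mul_le_mul_of_nonneg_left h3 (by positivity : 0 ≤ Lyx * DX * C / μ)
  have h5 : 1 ≤ (n : ℝ) ^ (1 / 2 : ℝ) := Real.one_le_rpow (by exact_mod_cast hn) (by norm_num)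
  have h6 : μ / (Lyy + μ) * ∑ t ∈ Finset.range n, e t
      ≤ (2 * DY + 2 * (Lyx * DX * C / μ)) * (n : ℝ) ^ (1 / 2 : ℝ) := by
    have := mul_le_mul_of_nonneg_left h5 (mul_nonneg two_pos.le hDY)
    linarith
  have h7 := mul_le_mul_of_nonneg_left h6 (by positivity : 0 ≤ (Lyy + μ) / μ)
  rwa [← mul_assoc, div_mul_div_cancel₀ hμ.ne', div_self (by positivity), one_mul, ← mul_assoc] at h7

/-- Summing squares instead of using `e ^ 2 ≤ DY * e` turns the drift into `1 / (t + 1)`, which is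
the source of the logarithm. -/
lemma sum_sq_e_le_of_strongly_concave
    (h : GapRecursion DX DY Lxx Lyx Lyy μ B B' τ (fun _ => 0) e φ G H) {C : ℝ}
    (hμ : 0 < μ) (hLyx : 0 ≤ Lyx) (hLyy : 0 ≤ Lyy) (hDX : 0 ≤ DX)
    (hτ : ∀ t : ℕ, τ t ≤ C * ((t : ℝ) + 1) ^ (-(1 / 2) : ℝ)) {n : ℕ} (hn : 1 ≤ n) :
    ∑ t ∈ Finset.range n, e t ^ 2 ≤ (Lyy + μ) / μ
      * (2 * DY ^ 2 + (Lyx * DX * C / μ) ^ 2 * ((Lyy + μ) / μ)) * (1 + Real.log n) := by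
  set P := Lyx * DX * C / μ with hP
  have hpt : ∀ t : ℕ, μ / (Lyy + μ) * e t ^ 2 ≤ 1 * (e t ^ 2 - e (t + 1) ^ 2)
      + P ^ 2 * ((Lyy + μ) / μ) * ((t : ℝ) + 1)⁻¹ := by
    intro t
    have hs : (0 : ℝ) < (t : ℝ) + 1 := by positivity
    have h1 := pow_le_pow_left₀ (h.e_nonneg (t + 1))
      (h.e_succ_of_strongly_concave hμ hLyx hDX hτ t) 2
    rw [← hP] at h1
    have h2 : (((t : ℝ) + 1) ^ (-(1 / 2) : ℝ)) ^ 2 = ((t : ℝ) + 1)⁻¹ := by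
      rw [← Real.rpow_natCast, ← Real.rpow_mul hs.le, ← Real.rpow_neg_one]
      norm_num
    rw [← h2]
    set p := P * ((t : ℝ) + 1) ^ (-(1 / 2) : ℝ) with hp
    have hd : 0 < Lyy + μ := by linarith
    -- Convexity of the square with explicit slack: for `q = Lyy / (Lyy + μ)`, `(q * e + p) ^ 2 ≤ q
    -- * e ^ 2 + p ^ 2 / (1 - q)`.
    have h3 : (1 - μ / (Lyy + μ)) * e t ^ 2 + p ^ 2 * ((Lyy + μ) / μ)
        - (Lyy / (Lyy + μ) * e t + p) ^ 2
        = Lyy * μ / (Lyy + μ) ^ 2 * (e t - p * ((Lyy + μ) / μ)) ^ 2 := by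
      field_simp
      ring
    have h4 : 0 ≤ Lyy * μ / (Lyy + μ) ^ 2 * (e t - p * ((Lyy + μ) / μ)) ^ 2 := by positivity
    rw [hp, mul_pow, ← hp] at h3
    linarith
  have habs : ∀ t, |e t ^ 2| ≤ DY ^ 2 := fun t => by
    rw [abs_of_nonneg (sq_nonneg _)]
    exact pow_le_pow_left₀ (h.e_nonneg t) (h.e_le t) 2
  have h1 := sum_le_of_weighted_descent (w := fun _ => 1) (φ := fun t => e t ^ 2) monotone_const
    zero_le_one habs hpt n
  rw [← Finset.mul_sum] at h1
  have h4 := mul_le_mul_of_nonneg_left (sum_one_div_le_one_add_log n)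
    (by positivity : 0 ≤ P ^ 2 * ((Lyy + μ) / μ))
  have h5 : 0 ≤ Real.log n := Real.log_nonneg (by exact_mod_cast hn)
  have h6 : μ / (Lyy + μ) * ∑ t ∈ Finset.range n, e t ^ 2
      ≤ (2 * DY ^ 2 + P ^ 2 * ((Lyy + μ) / μ)) * (1 + Real.log n) := by
    have : 0 ≤ DY ^ 2 * Real.log n := by positivity
    linarith
  have h7 := mul_le_mul_of_nonneg_left h6 (by positivity : 0 ≤ (Lyy + μ) / μ)
  rwa [← mul_assoc, div_mul_div_cancel₀ hμ.ne', div_self (by positivity), one_mul, ← mul_assoc] at h7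

lemma sum_primal_le_of_strongly_concave
    (h : GapRecursion DX DY Lxx Lyx Lyy μ B B' τ (fun _ => 0) e φ G H)
    {C C₁ N S : ℝ} (hμ : 0 < μ) (hLxx : 0 ≤ Lxx) (hLyx : 0 ≤ Lyx) (hDX : 0 ≤ DX) (hC : 0 < C)
    (hC₁ : 0 < C₁) (hN : 0 ≤ N) (hτ0 : ∀ t, 0 ≤ τ t)
    (hτ : ∀ t : ℕ, τ t ≤ C * ((t : ℝ) + 1) ^ (-(1 / 2) : ℝ))
    (hτlow : ∀ t : ℕ, 1 ≤ C₁ * ((t : ℝ) + 1) ^ (1 / 2 : ℝ) * τ t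
      + N * ((t : ℝ) + 1) ^ (-(1 / 2) : ℝ)) {n : ℕ} (hn : 1 ≤ n)
    (hS : ∑ t ∈ Finset.range n, e t ≤ S * (n : ℝ) ^ (1 / 2 : ℝ)) :
    ∑ t ∈ Finset.range n, G t ≤ (4 * B * C₁ + C₁ * (Lyx * DX * C) * S
      + 2 * (C₁ * ((Lxx / 2 + Lyx ^ 2 / μ) * DX ^ 2 * C ^ 2) + N * B'))
        * (n : ℝ) ^ (1 / 2 : ℝ) := by
  have hB : 0 ≤ B := (abs_nonneg _).trans (h.abs_φ_le 0)
  have hB' : 0 ≤ B' := (h.G_nonneg 0).trans (h.G_le 0)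
  have hpt : ∀ t : ℕ, 1 * G t ≤ C₁ * ((t : ℝ) + 1) ^ (1 / 2 : ℝ) * (φ t - φ (t + 1))
      + (C₁ * (Lyx * DX * C) * e t
        + (C₁ * ((Lxx / 2 + Lyx ^ 2 / μ) * DX ^ 2 * C ^ 2) + N * B')
          * ((t : ℝ) + 1) ^ (-(1 / 2) : ℝ)) := by
    intro t
    have hs : (0 : ℝ) < (t : ℝ) + 1 := by positivity
    have he := h.e_nonneg t
    have hτt := hτ0 t
    have hGt := h.G_nonneg t
    have r1 : ((t : ℝ) + 1) ^ (1 / 2 : ℝ) * ((t : ℝ) + 1) ^ (-(1 / 2) : ℝ) = 1 := by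
      rw [← Real.rpow_add hs]
      norm_num
    set w := ((t : ℝ) + 1) ^ (1 / 2 : ℝ) with hw
    have hw0 : 0 < w := by positivity
    have hwτ : w * τ t ≤ C := by
      have := mul_le_mul_of_nonneg_left (hτ t) hw0.le
      rwa [mul_left_comm, r1, mul_one] at this
    have hquad : w * ((Lxx / 2 + Lyx ^ 2 / μ) * (τ t * DX) ^ 2)
        ≤ (Lxx / 2 + Lyx ^ 2 / μ) * DX ^ 2 * C ^ 2 * ((t : ℝ) + 1) ^ (-(1 / 2) : ℝ) := by
      calc w * ((Lxx / 2 + Lyx ^ 2 / μ) * (τ t * DX) ^ 2)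
          = (Lxx / 2 + Lyx ^ 2 / μ) * DX ^ 2 * ((w * τ t) * τ t) := by ring
        _ ≤ (Lxx / 2 + Lyx ^ 2 / μ) * DX ^ 2
            * (C * (C * ((t : ℝ) + 1) ^ (-(1 / 2) : ℝ))) := by
          have := hτ t
          gcongr
        _ = _ := by ring
    have hlin : w * (Lyx * DX * (τ t * e t)) ≤ Lyx * DX * C * e t := by
      calc w * (Lyx * DX * (τ t * e t)) = Lyx * DX * (w * τ t) * e t := by ring
        _ ≤ _ := by gcongr
    have h1 : G t ≤ C₁ * (w * (τ t * G t)) + N * B' * ((t : ℝ) + 1) ^ (-(1 / 2) : ℝ) := by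
      have h2 := mul_le_mul_of_nonneg_right (hτlow t) hGt
      have h3 : N * ((t : ℝ) + 1) ^ (-(1 / 2) : ℝ) * G t
          ≤ N * ((t : ℝ) + 1) ^ (-(1 / 2) : ℝ) * B' := by
        have := h.G_le t
        gcongr
      linarith
    have h4 := h.primal t
    rw [add_zero] at h4
    replace h4 := mul_le_mul_of_nonneg_left h4 hw0.le
    have h5 : w * (τ t * G t) ≤ w * (φ t - φ (t + 1)) + Lyx * DX * C * e t
        + (Lxx / 2 + Lyx ^ 2 / μ) * DX ^ 2 * C ^ 2 * ((t : ℝ) + 1) ^ (-(1 / 2) : ℝ) := by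
      linarith
    have h6 := mul_le_mul_of_nonneg_left h5 hC₁.le
    linarith
  have hw : Monotone (fun t : ℕ => C₁ * ((t : ℝ) + 1) ^ (1 / 2 : ℝ)) := by
    intro i j hij
    have : (i : ℝ) ≤ j := by exact_mod_cast hij
    dsimp only
    gcongr
  have h1 := sum_le_of_weighted_descent hw (by positivity) h.abs_φ_le hpt n
  rw [Finset.sum_add_distrib, ← Finset.mul_sum, ← Finset.mul_sum] at h1
  have h3 := sum_rpow_neg_le (a := 1 / 2) (by norm_num) (by norm_num) n
  rw [show (1 : ℝ) - 1 / 2 = 1 / 2 by norm_num] at h3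
  have h5 := add_one_rpow_le (a := 1 / 2) (b := 1 / 2) (by norm_num) (by norm_num) (by norm_num) hn
  have h6 := mul_le_mul_of_nonneg_left hS (by positivity : 0 ≤ C₁ * (Lyx * DX * C))
  have h7 := mul_le_mul_of_nonneg_left h3
    (by positivity : 0 ≤ C₁ * ((Lxx / 2 + Lyx ^ 2 / μ) * DX ^ 2 * C ^ 2) + N * B')
  have h8 := mul_le_mul_of_nonneg_left h5 (by positivity : 0 ≤ 2 * B * C₁)
  linarith

/-- Without bias every term is of second order in `(e, τ)`, the cross term by `2 τ e ≤ τ² + e²`. -/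
lemma sum_dual_le_of_strongly_concave
    (h : GapRecursion DX DY Lxx Lyx Lyy μ B B' τ (fun _ => 0) e φ G H)
    {C S : ℝ} (hμ : 0 < μ) (hLxx : 0 ≤ Lxx) (hLyx : 0 ≤ Lyx) (hLyy : 0 ≤ Lyy) (hDX : 0 ≤ DX)
    (hτ0 : ∀ t, 0 ≤ τ t)
    (hτ : ∀ t : ℕ, τ t ≤ C * ((t : ℝ) + 1) ^ (-(1 / 2) : ℝ)) {n : ℕ}
    (hS : ∑ t ∈ Finset.range n, e t ^ 2 ≤ S * (1 + Real.log n)) :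
    ∑ t ∈ Finset.range n, H (t + 1) ≤ ((Lyy / 2 + Lyx * DX / 2) * S
      + (Lyx * DX / 2 + (Lxx + Lyx ^ 2 / μ) * DX ^ 2) * C ^ 2) * (1 + Real.log n) := by
  have hpt : ∀ t : ℕ, H (t + 1) ≤ (Lyy / 2 + Lyx * DX / 2) * e t ^ 2
      + (Lyx * DX / 2 + (Lxx + Lyx ^ 2 / μ) * DX ^ 2) * C ^ 2 * ((t : ℝ) + 1)⁻¹ := by
    intro t
    have hs : (0 : ℝ) < (t : ℝ) + 1 := by positivity
    have h1 := h.dual t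
    simp only [add_zero, zero_div, zero_mul] at h1
    have h2 : (((t : ℝ) + 1) ^ (-(1 / 2) : ℝ)) ^ 2 = ((t : ℝ) + 1)⁻¹ := by
      rw [← Real.rpow_natCast, ← Real.rpow_mul hs.le, ← Real.rpow_neg_one]
      norm_num
    have h3 := pow_le_pow_left₀ (hτ0 t) (hτ t) 2
    rw [mul_pow, h2] at h3
    have h4 : τ t * e t ≤ (τ t ^ 2 + e t ^ 2) / 2 := by linarith [two_mul_le_add_sq (τ t) (e t)]
    have h5 := mul_le_mul_of_nonneg_left h4 (by positivity : 0 ≤ Lyx * DX)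
    have h6 := mul_le_mul_of_nonneg_left h3
      (by positivity : 0 ≤ Lyx * DX / 2 + (Lxx + Lyx ^ 2 / μ) * DX ^ 2)
    rw [mul_pow] at h1
    linarith
  refine (Finset.sum_le_sum fun t _ => hpt t).trans ?_
  rw [Finset.sum_add_distrib, ← Finset.mul_sum, ← Finset.mul_sum]
  have h6 := mul_le_mul_of_nonneg_left hS (by positivity : 0 ≤ Lyy / 2 + Lyx * DX / 2)
  have h7 := mul_le_mul_of_nonneg_left (sum_one_div_le_one_add_log n)
    (by positivity : 0 ≤ (Lyx * DX / 2 + (Lxx + Lyx ^ 2 / μ) * DX ^ 2) * C ^ 2)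
  linarith

end GapRecursion

/-! ### Averages and the final assembly. -/

lemma sum_Icc_one_le_sum_range {u : ℕ → ℝ} (hu : ∀ t, 0 ≤ u t) (T : ℕ) :
    ∑ t ∈ Finset.Icc 1 T, u t ≤ ∑ t ∈ Finset.range (T + 1), u t := by
  refine Finset.sum_le_sum_of_subset_of_nonneg (fun t ht => ?_) fun t _ _ => hu t
  rw [Finset.mem_Icc] at ht
  exact Finset.mem_range.2 (by omega)

lemma sum_Icc_one_eq_sum_range (u : ℕ → ℝ) (T : ℕ) :
    ∑ t ∈ Finset.Icc 1 T, u t = ∑ t ∈ Finset.range T, u (t + 1) := by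
  rw [← Finset.Ico_add_one_right_eq_Icc, Finset.sum_Ico_eq_sum_range, Nat.add_sub_cancel]
  exact Finset.sum_congr rfl fun t _ => by rw [add_comm]

lemma average_le_rpow {S K K' a b : ℝ} {T : ℕ} (hT : 1 ≤ T) (hab : b = a - 1) (hK : K ≤ K')
    (h : S ≤ K * (T : ℝ) ^ a) : 1 / (T : ℝ) * S ≤ K' * (T : ℝ) ^ b := by
  have hT' : (0 : ℝ) < T := by exact_mod_cast hT
  rw [hab, Real.rpow_sub_one hT'.ne', one_div_mul_eq_div, ← mul_div_assoc]
  gcongr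
  exact h.trans (by gcongr)

/-- A bound on the first `T + 1` terms bounds the average of the terms `1, …, T`. -/
lemma average_le_of_sum_range_succ_le {u : ℕ → ℝ} {K K' a b : ℝ} {T : ℕ} (hu : ∀ t, 0 ≤ u t)
    (hT : 1 ≤ T) (ha0 : 0 ≤ a) (ha1 : a ≤ 1) (hab : b = a - 1) (hK : 2 * |K| ≤ K')
    (h : ∑ t ∈ Finset.range (T + 1), u t ≤ K * ((T + 1 : ℕ) : ℝ) ^ a) :
    1 / (T : ℝ) * ∑ t ∈ Finset.Icc 1 T, u t ≤ K' * (T : ℝ) ^ b := by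
  refine average_le_rpow hT hab hK ((sum_Icc_one_le_sum_range hu T).trans (h.trans ?_))
  have h1 := add_one_rpow_le ha0 le_rfl ha1 hT
  push_cast
  calc K * ((T : ℝ) + 1) ^ a ≤ |K| * (2 * (T : ℝ) ^ a) := by
        gcongr
        exact le_abs_self K
    _ = _ := by ring

theorem theorem3 :
    -- NC-C
    (∀ (DX DY M μ Lxx Lyx Lyy : ℝ) (τ β : ℕ → ℝ),
      (∀ t, 0 ≤ τ t ∧ τ t ≤ 1) →
      τ =Θ[atTop] (fun t : ℕ => (t : ℝ) ^ (-(3 / 4) : ℝ)) →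
      (∀ t, 0 < β t) → Antitone β →
      β =Θ[atTop] (fun t : ℕ => (t : ℝ) ^ (-(1 / 4) : ℝ)) →
      ∃ K : ℝ, ∀ (nx ny : ℕ) (X : Set (Euc nx)) (Y : Set (Euc ny)) (L : Euc nx → Euc ny → ℝ),
        MinimaxAssumption X Y L μ Lxx Lyx Lyy →
        Metric.diam X ≤ DX → Metric.diam Y ≤ DY → (∀ x ∈ X, |primalFun Y L x| ≤ M) →
        ∀ (x : ℕ → Euc nx) (y : ℕ → Euc ny), IsLMOPO X Y L Lyy τ β x y →
        ∀ T : ℕ, 1 ≤ T →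
          (1 / (T : ℝ)) * ∑ t ∈ Finset.Icc 1 T, fwGap X L (x t) (y t)
            ≤ K * (T : ℝ) ^ (-(1 / 4) : ℝ) ∧
          (1 / (T : ℝ)) * ∑ t ∈ Finset.Icc 1 T, dualGap Y L (x t) (y t)
            ≤ K * (T : ℝ) ^ (-(1 / 4) : ℝ)) ∧
    -- NC-SC
    (∀ (DX DY M μ Lxx Lyx Lyy : ℝ) (τ : ℕ → ℝ),
      0 < μ →
      (∀ t, 0 ≤ τ t ∧ τ t ≤ 1) →
      τ =Θ[atTop] (fun t : ℕ => (t : ℝ) ^ (-(1 / 2) : ℝ)) →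
      ∃ K : ℝ, ∀ (nx ny : ℕ) (X : Set (Euc nx)) (Y : Set (Euc ny)) (L : Euc nx → Euc ny → ℝ),
        MinimaxAssumption X Y L μ Lxx Lyx Lyy →
        Metric.diam X ≤ DX → Metric.diam Y ≤ DY → (∀ x ∈ X, |primalFun Y L x| ≤ M) →
        ∀ (x : ℕ → Euc nx) (y : ℕ → Euc ny), IsLMOPO X Y L Lyy τ (fun _ => 0) x y →
        ∀ T : ℕ, 1 ≤ T →
          (1 / (T : ℝ)) * ∑ t ∈ Finset.Icc 1 T, fwGap X L (x t) (y t)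
            ≤ K * (T : ℝ) ^ (-(1 / 2) : ℝ) ∧
          (1 / (T : ℝ)) * ∑ t ∈ Finset.Icc 1 T, dualGap Y L (x t) (y t)
            ≤ K * ((1 + Real.log T) / T)) := by
  constructor
  · intro DX DY M μ Lxx Lyx Lyy τ β hτ01 hτΘ hβ hanti hβΘ
    obtain ⟨C, hC, hτ⟩ := exists_forall_le_rpow (by norm_num) (by norm_num)
      (fun t => (hτ01 t).2) hτΘ.1
    obtain ⟨C₁, N, hC₁, hN, hτlow⟩ := exists_forall_one_le (b := 1 / 2) (by norm_num)
      (by norm_num) (fun t => (hτ01 t).1) hτΘ.2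
    obtain ⟨C₂, hC₂, hβup⟩ := exists_forall_le_rpow (by norm_num) (by norm_num)
      (fun t => hanti (Nat.zero_le t)) hβΘ.1
    obtain ⟨Cb, hCb, hβlow⟩ := exists_forall_rpow_le_of_antitone (by norm_num) hβ hanti hβΘ.2
    -- The constants precede `X`, so the sign of `DX` is not yet known; a negative `DX` admits no
    -- instance.
    by_cases hDX : 0 ≤ DX
    swap
    · exact ⟨0, fun nx ny X Y L _ hX => absurd (Metric.diam_nonneg.trans hX) hDX⟩
    set S := Cb * (Lyy + μ + 2 * β 0)
      * (4 * DY + Cb * Lyx * DX * C * (4 / 3) + 4 * (Cb * DY) * β 0) with hS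
    set B := M + β 0 / 2 * DY ^ 2 with hB
    set B' := 2 * M + Lyx * DY * DX + Lxx / 2 * DX ^ 2 with hB'
    set K₁ := 4 * B * C₁ + C₁ * (Lyx * DX * C) * S
      + 2 * (C₁ * ((Lxx / 2 + Lyx ^ 2 * Cb) * DX ^ 2 * C ^ 2) + N * B') with hK₁
    set K₂ := ((Lyy + β 0) / 2 * DY + Lyx * DX) * S
      + ((Lxx + Lyx ^ 2 * Cb) * DX ^ 2 * C ^ 2 + C₂ / 2 * DY ^ 2) * (4 / 3) with hK₂
    -- The primal sum runs over `T + 1` terms, and `(T + 1) ^ a ≤ 2 * T ^ a` gives the factor `2`.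
    -- The dual bound concerns index `t + 1` and needs no such loss.
    refine ⟨max (2 * |K₁|) K₂, fun nx ny X Y L h hX hY hM x y hrun T hT => ?_⟩
    obtain ⟨e, φ, hrec⟩ := hrun.exists_gapRecursion h hX hY hM hτ01 (fun t => (hβ t).le) hanti
      (fun t => add_pos_of_nonneg_of_pos h.mu_nonneg (hβ t))
    have hsum : ∀ n, 1 ≤ n → ∑ t ∈ Finset.range n, e t ≤ S * (n : ℝ) ^ (3 / 4 : ℝ) :=
      fun n hn => hrec.sum_e_le_of_concave h.mu_nonneg h.Lyx_pos.le h.Lyy_nonneg hDX hC hCb hτ hβ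
        hanti hβlow hn
    constructor
    · exact average_le_of_sum_range_succ_le hrec.G_nonneg hT (by norm_num) (by norm_num)
        (by norm_num) (le_max_left _ _)
        (hrec.sum_primal_le_of_concave h.mu_nonneg h.Lxx_nonneg h.Lyx_pos.le hDX hC hCb hC₁ hN
          (fun t => (hτ01 t).1) hτ hτlow hβ hβlow (by omega) (hsum _ (by omega)))
    · rw [sum_Icc_one_eq_sum_range]
      exact average_le_rpow hT (by norm_num) (le_max_right _ _)
        (hrec.sum_dual_le_of_concave h.mu_nonneg h.Lxx_nonneg h.Lyx_pos.le h.Lyy_nonneg hDX hC hCb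
          hC₂ hτ01 hτ hβ hanti hβlow hβup (hsum T hT))
  · intro DX DY M μ Lxx Lyx Lyy τ hμ hτ01 hτΘ
    obtain ⟨C, hC, hτ⟩ := exists_forall_le_rpow (by norm_num) (by norm_num)
      (fun t => (hτ01 t).2) hτΘ.1
    obtain ⟨C₁, N, hC₁, hN, hτlow⟩ := exists_forall_one_le (b := 1 / 2) (by norm_num)
      (by norm_num) (fun t => (hτ01 t).1) hτΘ.2
    by_cases hDX : 0 ≤ DX
    swap
    · exact ⟨0, fun nx ny X Y L _ hX => absurd (Metric.diam_nonneg.trans hX) hDX⟩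
    set S := (Lyy + μ) / μ * (2 * DY + 2 * (Lyx * DX * C / μ)) with hS
    set S' := (Lyy + μ) / μ
      * (2 * DY ^ 2 + (Lyx * DX * C / μ) ^ 2 * ((Lyy + μ) / μ)) with hS'
    set B := M + (0 : ℝ) / 2 * DY ^ 2 with hB
    set B' := 2 * M + Lyx * DY * DX + Lxx / 2 * DX ^ 2 with hB'
    set K₁ := 4 * B * C₁ + C₁ * (Lyx * DX * C) * S
      + 2 * (C₁ * ((Lxx / 2 + Lyx ^ 2 / μ) * DX ^ 2 * C ^ 2) + N * B') with hK₁
    set K₂ := (Lyy / 2 + Lyx * DX / 2) * S'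
      + (Lyx * DX / 2 + (Lxx + Lyx ^ 2 / μ) * DX ^ 2) * C ^ 2 with hK₂
    refine ⟨max (2 * |K₁|) K₂, fun nx ny X Y L h hX hY hM x y hrun T hT => ?_⟩
    obtain ⟨e, φ, hrec⟩ := hrun.exists_gapRecursion h hX hY hM hτ01 (fun _ => le_rfl)
      antitone_const (fun _ => by simpa using hμ)
    constructor
    · exact average_le_of_sum_range_succ_le hrec.G_nonneg hT (by norm_num) (by norm_num)
        (by norm_num) (le_max_left _ _)
        (hrec.sum_primal_le_of_strongly_concave hμ h.Lxx_nonneg h.Lyx_pos.le hDX hC hC₁ hN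
          (fun t => (hτ01 t).1) hτ hτlow (by omega)
          (hrec.sum_e_le_of_strongly_concave hμ h.Lyx_pos.le h.Lyy_nonneg hDX hC hτ (by omega)))
    · rw [sum_Icc_one_eq_sum_range]
      have h1 := hrec.sum_dual_le_of_strongly_concave hμ h.Lxx_nonneg h.Lyx_pos.le h.Lyy_nonneg hDX
        (fun t => (hτ01 t).1) hτ (hrec.sum_sq_e_le_of_strongly_concave hμ h.Lyx_pos.le
          h.Lyy_nonneg hDX hτ hT)
      have h2 : 0 ≤ Real.log T := Real.log_nonneg (by exact_mod_cast hT)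
      rw [one_div_mul_eq_div, ← mul_div_assoc]
      gcongr
      exact h1.trans (by gcongr; exact le_max_right _ _)
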